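/- \textbf{Definitions.} Algebras are associative, unital, over $\mathbb{C}$. Let $\mathcal{A},\mathcal{B}$ be algebras with linear bijections $v_{\mathcal{A}}:\mathcal{A}\to\mathbb{C}^n$, $v_{\mathcal{B}}:\mathcal{B}\to\mathbb{C}^m$. The associated \emph{generalized Schur product} is the unique bilinear product $*$ on the $n\times m$ complex matrices with $v_{\mathcal{A}}(a)v_{\mathcal{B}}(b)^* * v_{\mathcal{A}}(c)v_{\mathcal{B}}(d)^* = v_{\mathcal{A}}(ac)v_{\mathcal{B}}(bd)^*$ for all $a,c\in\mathcal A$, $b,d\in\mathcal B$. Write $\mathcal{S}_*$ for the resulting unital algebra of $n\times m$ matrices. Fix $d,N\in\mathbb{N}$. Let $\mathcal{S}^d=\bigsqcup_*\mathcal{S}_*^d$ and $\mathcal{S}^{N\times N}=\bigsqcup_* M_N(\mathbb{C})\otimes\mathcal{S}_*$, the disjoint unions running over all sizes $n,m$ and all generalized Schur products $*$. A tuple $X=(X_1,\dots,X_d)\in\mathcal{S}_*^d$ is a \emph{Schur spectral contraction} if there are matrices $A_i\in M_m(\mathbb{C})$, $B_i\in M_n(\mathbb{C})$ such that every block matrix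 $Z_i=\left[\begin{smallmatrix}A_i&X_i^*\\X_i&B_i\end{smallmatrix}\right]$ is positive definite and the joint spectral radius $\limsup_{k\to\infty}\max_{|\alpha|=k}\|Z^\alpha\|^{1/k}$ is less than $1$, where the products $Z^\alpha$ are formed with the generalized Schur product on $(m+n)\times(m+n)$ matrices given by the direct sum $\mathcal{B}\oplus\mathcal{A}$, with the bijection $v_{\mathcal B}\oplus v_{\mathcal A}$, on both sides. Let $\mathcal{C}^d\subseteq\mathcal{S}^d$ be the set of Schur spectral contractions. A \emph{scalar noncommutative function} on $\mathcal{C}^d$ assigns to each $X\in\mathcal{C}^d$ an element $f(X)$ of the unital algebra generated by $X_1,\dots,X_d$ in its $\mathcal{S}_*$, in such a way that $f(Y)=\varphi(f(X))$ whenever $X,Y\in\mathcal{C}^d$ (possibly for different products) and $\varphi$ is a unital algebra homomorphism from the algebra generated by $X_1,\dots,X_d$ to the algebra generated by $Y_1,\dots,Y_d$ with $\varphi(X_i)=Y_i$ for all $i$. A \emph{noncommutative function} $f:\mathcal{C}^d\to\mathcal{S}^{N\times N}$ is a function each of whose $N^2$ block entries is a scalar noncommutative function. It is \emph{positivity preserving}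 if $f(X)\ge 0$ (positive semi-definite) whenever $X\in\mathcal{C}^d\cap\mathcal{S}_*^d$, $*$ is a product on square matrices for which the product of any two positive semi-definite matrices is positive semi-definite, and every $X_i\geq 0$. \textbf{Theorem (The noncommutative Schoenberg theorem).} Let $f:\mathcal{C}^d\to\mathcal{S}^{N\times N}$ be a positivity preserving noncommutative function on the set of Schur spectral contractions. Then there are matrices $c_\alpha\in M_N(\mathbb{C})$, indexed by the words $\alpha$ in $d$ letters (including the empty word), with every $c_\alpha\ge 0$ (positive semi-definite; a nonnegative number when $N=1$), such that for every $X\in\mathcal{C}^d$ the series $$f(X)=\sum_\alpha c_\alpha\otimes X^\alpha$$ converges unconditionally (equivalently, absolutely) to $f(X)$, where $X^\alpha$ is evaluated with the underlying generalized Schur product $*$ of $X$ (and $X^{\emptyset}$ is the identity element of $*$). -/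

import Mathlib

open scoped ComplexOrder Kronecker ENNReal

noncomputable section

/-- Two unital algebras `𝒜`, `ℬ` over `ℂ` together with linear bijections onto the spaces of
column vectors indexed by `ι` and by `κ`. -/
structure SchurData (ι κ : Type) where
  𝒜 : Type
  ℬ : Type
  [ringA : Ring 𝒜]
  [algebraA : Algebra ℂ 𝒜]
  [ringB : Ring ℬ]
  [algebraB : Algebra ℂ ℬ]
  vA : 𝒜 ≃ₗ[ℂ] (ι → ℂ)
  vB : ℬ ≃ₗ[ℂ] (κ → ℂ)

attribute [instance] SchurData.ringA SchurData.algebraA SchurData.ringB SchurData.algebraB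

namespace SchurData

variable {ι κ : Type}

/-- The matrix `v_𝒜(a) v_ℬ(b)^*`. -/
def rankOne (P : SchurData ι κ) (a : P.𝒜) (b : P.ℬ) : Matrix ι κ ℂ :=
  Matrix.vecMulVec (P.vA a) (star (P.vB b))

/-- The defining relation
`v_𝒜(a) v_ℬ(b)^* * v_𝒜(c) v_ℬ(d)^* = v_𝒜(ac) v_ℬ(bd)^*` of a generalized Schur product. -/
def Presents (P : SchurData ι κ)
    (mul : Matrix ι κ ℂ →ₗ[ℂ] Matrix ι κ ℂ →ₗ[ℂ] Matrix ι κ ℂ) : Prop :=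
  ∀ a b c d, mul (P.rankOne a b) (P.rankOne c d) = P.rankOne (a * c) (b * d)

theorem rankOne_induction [Fintype ι] [Fintype κ] [DecidableEq ι] [DecidableEq κ]
    (P : SchurData ι κ) {p : Matrix ι κ ℂ → Prop}
    (h : ∀ a b, p (P.rankOne a b)) (hadd : ∀ X Y, p X → p Y → p (X + Y)) (X : Matrix ι κ ℂ) :
    p X := by
  induction X using Matrix.induction_on' with
  | h_zero =>
    have := h 0 0
    simpa [rankOne] using this
  | h_add X Y hX hY => exact hadd X Y hX hY
  | h_std_basis i j x =>
    have := h (P.vA.symm (Pi.single i x)) (P.vB.symm (Pi.single j 1))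
    have e : P.rankOne (P.vA.symm (Pi.single i x)) (P.vB.symm (Pi.single j 1))
        = Matrix.single i j x := by
      ext k l
      simp only [rankOne, LinearEquiv.apply_symm_apply, Matrix.vecMulVec_apply, Pi.star_apply,
        Matrix.single_apply, Pi.single_apply]
      rcases eq_or_ne i k with rfl | hk <;> rcases eq_or_ne j l with rfl | hl <;>
        simp_all [Ne.symm]
    rwa [e] at this

/-- At most one bilinear product satisfies the defining relation. -/
theorem Presents.unique [Fintype ι] [Fintype κ] [DecidableEq ι] [DecidableEq κ]
    {P : SchurData ι κ} {mul mul' : Matrix ι κ ℂ →ₗ[ℂ] Matrix ι κ ℂ →ₗ[ℂ] Matrix ι κ ℂ}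
    (h : P.Presents mul) (h' : P.Presents mul') : mul = mul' := by
  refine LinearMap.ext fun X => LinearMap.ext fun Y => ?_
  induction X using P.rankOne_induction with
  | hadd X X' hX hX' => simp [hX, hX']
  | h a b =>
    induction Y using P.rankOne_induction with
    | hadd Y Y' hY hY' => simp [hY, hY']
    | h c d => rw [h, h']

/-- The bilinear product determined by the two algebras, written in coordinates. -/
def mul [Fintype ι] [Fintype κ] [DecidableEq ι] [DecidableEq κ] (P : SchurData ι κ) :
    Matrix ι κ ℂ →ₗ[ℂ] Matrix ι κ ℂ →ₗ[ℂ] Matrix ι κ ℂ :=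
  LinearMap.mk₂ ℂ
    (fun X Y => ∑ k, ∑ l, ∑ k', ∑ l', (X k l * Y k' l') •
      P.rankOne (P.vA.symm (Pi.single k 1) * P.vA.symm (Pi.single k' 1))
        (P.vB.symm (Pi.single l 1) * P.vB.symm (Pi.single l' 1)))
    (by intros; simp only [Matrix.add_apply, add_mul, add_smul, Finset.sum_add_distrib])
    (by intros; simp only [Matrix.smul_apply, smul_eq_mul, mul_assoc, mul_smul, Finset.smul_sum])
    (by intros; simp only [Matrix.add_apply, mul_add, add_smul, Finset.sum_add_distrib])
    (by
      intros
      simp only [Matrix.smul_apply, smul_eq_mul, mul_left_comm, mul_smul, Finset.smul_sum])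

theorem presents_mul [Fintype ι] [Fintype κ] [DecidableEq ι] [DecidableEq κ]
    (P : SchurData ι κ) : P.Presents P.mul := by
  intro a b c d
  have hA : ∀ x : P.𝒜, x = ∑ k, P.vA x k • P.vA.symm (Pi.single k 1) := by
    intro x
    apply P.vA.injective
    ext i
    simp [map_sum, Finset.sum_apply, Pi.single_apply]
  have hB : ∀ x : P.ℬ, x = ∑ k, P.vB x k • P.vB.symm (Pi.single k 1) := by
    intro x
    apply P.vB.injective
    ext i
    simp [map_sum, Finset.sum_apply, Pi.single_apply]
  have hac : a * c = ∑ k, ∑ k', (P.vA a k * P.vA c k') •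
      (P.vA.symm (Pi.single k 1) * P.vA.symm (Pi.single k' 1)) := by
    conv_lhs => rw [hA a, hA c]
    simp only [Finset.sum_mul_sum, smul_mul_smul_comm]
  have hbd : b * d = ∑ k, ∑ k', (P.vB b k * P.vB d k') •
      (P.vB.symm (Pi.single k 1) * P.vB.symm (Pi.single k' 1)) := by
    conv_lhs => rw [hB b, hB d]
    simp only [Finset.sum_mul_sum, smul_mul_smul_comm]
  ext i j
  rw [hac, hbd]
  simp only [mul, LinearMap.mk₂_apply, rankOne, Matrix.sum_apply, Matrix.smul_apply,
    Matrix.vecMulVec_apply, map_sum, map_smul, Finset.sum_apply, Pi.smul_apply, Pi.star_apply,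
    smul_eq_mul, star_sum, star_mul', Finset.sum_mul, Finset.mul_sum]
  refine Finset.sum_comm.trans (Finset.sum_congr rfl fun l _ => ?_)
  refine (Finset.sum_congr rfl fun k _ => Finset.sum_comm).trans ?_
  refine Finset.sum_comm.trans (Finset.sum_congr rfl fun l' _ => ?_)
  refine Finset.sum_congr rfl fun k _ => Finset.sum_congr rfl fun k' _ => ?_
  ring

/-- The data for the direct sum algebra `ℬ ⊕ 𝒜` on both sides, on square matrices whose rows and
columns are indexed by `κ ⊕ ι`. -/
def directSum (P : SchurData ι κ) : SchurData (κ ⊕ ι) (κ ⊕ ι) where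
  𝒜 := P.ℬ × P.𝒜
  ℬ := P.ℬ × P.𝒜
  vA := (P.vB.prodCongr P.vA) ≪≫ₗ (LinearEquiv.sumArrowLequivProdArrow κ ι ℂ ℂ).symm
  vB := (P.vB.prodCongr P.vA) ≪≫ₗ (LinearEquiv.sumArrowLequivProdArrow κ ι ℂ ℂ).symm

end SchurData

/-- A generalized Schur product on the `ι` by `κ` matrices. -/
structure GenSchurProduct (ι κ : Type) where
  mul : Matrix ι κ ℂ →ₗ[ℂ] Matrix ι κ ℂ →ₗ[ℂ] Matrix ι κ ℂ
  exists_data : ∃ P : SchurData ι κ, P.Presents mul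

/-- The generalized Schur product defined by two algebras with linear bijections. -/
def SchurData.product {ι κ : Type} [Fintype ι] [Fintype κ] [DecidableEq ι] [DecidableEq κ]
    (P : SchurData ι κ) : GenSchurProduct ι κ :=
  ⟨P.mul, P, P.presents_mul⟩

namespace GenSchurProduct

variable {ι κ : Type}

/-- The algebra of `ι` by `κ` matrices equipped with the product `*`. -/
def Alg (_S : GenSchurProduct ι κ) : Type := Matrix ι κ ℂ

instance (S : GenSchurProduct ι κ) : AddCommGroup S.Alg :=
  inferInstanceAs (AddCommGroup (Matrix ι κ ℂ))

instance (S : GenSchurProduct ι κ) : Module ℂ S.Alg :=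
  inferInstanceAs (Module ℂ (Matrix ι κ ℂ))

/-- The underlying matrix of an element of the algebra. -/
def toMatrix (S : GenSchurProduct ι κ) : S.Alg ≃ₗ[ℂ] Matrix ι κ ℂ :=
  LinearEquiv.refl ℂ (Matrix ι κ ℂ)

/-- The identity element `v_𝒜(1) v_ℬ(1)^*`. -/
def one (S : GenSchurProduct ι κ) : Matrix ι κ ℂ :=
  S.exists_data.choose.rankOne 1 1

variable [Fintype ι] [Fintype κ] [DecidableEq ι] [DecidableEq κ]

theorem one_mul' (S : GenSchurProduct ι κ) (X : Matrix ι κ ℂ) : S.mul S.one X = X := by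
  induction X using S.exists_data.choose.rankOne_induction with
  | hadd X Y hX hY => rw [map_add, hX, hY]
  | h a b => rw [one, S.exists_data.choose_spec, one_mul, one_mul]

theorem mul_one' (S : GenSchurProduct ι κ) (X : Matrix ι κ ℂ) : S.mul X S.one = X := by
  induction X using S.exists_data.choose.rankOne_induction with
  | hadd X Y hX hY => rw [map_add, LinearMap.add_apply, hX, hY]
  | h a b => rw [one, S.exists_data.choose_spec, mul_one, mul_one]

theorem mul_assoc' (S : GenSchurProduct ι κ) (X Y Z : Matrix ι κ ℂ) :
    S.mul (S.mul X Y) Z = S.mul X (S.mul Y Z) := by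
  obtain ⟨P, hP⟩ := S.exists_data
  induction X using P.rankOne_induction with
  | hadd X X' hX hX' => simp only [map_add, LinearMap.add_apply, hX, hX']
  | h a b =>
    induction Y using P.rankOne_induction with
    | hadd Y Y' hY hY' => simp only [map_add, LinearMap.add_apply, hY, hY']
    | h a' b' =>
      induction Z using P.rankOne_induction with
      | hadd Z Z' hZ hZ' => simp only [map_add, hZ, hZ']
      | h a'' b'' => simp only [hP _ _ _ _, mul_assoc]

instance (S : GenSchurProduct ι κ) : Ring S.Alg where
  __ := (inferInstance : AddCommGroup S.Alg)
  mul X Y := S.toMatrix.symm (S.mul (S.toMatrix X) (S.toMatrix Y))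
  one := S.toMatrix.symm S.one
  left_distrib X Y Z := map_add (S.mul X) Y Z
  right_distrib X Y Z := LinearMap.map_add₂ S.mul X Y Z
  zero_mul X := LinearMap.map_zero₂ S.mul X
  mul_zero X := map_zero (S.mul X)
  mul_assoc X Y Z := S.mul_assoc' X Y Z
  one_mul X := S.one_mul' X
  mul_one X := S.mul_one' X

instance (S : GenSchurProduct ι κ) : Algebra ℂ S.Alg :=
  Algebra.ofModule (fun r X Y => LinearMap.map_smul₂ S.mul r X Y)
    (fun r X Y => map_smul (S.mul X) r Y)

/-- The monomial `X^α = X_{α₁} * ⋯ * X_{α_k}` of a word `α`; the empty word gives the identity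
element of `*`. -/
def monomial (S : GenSchurProduct ι κ) {d : ℕ} (X : Fin d → S.Alg) (α : List (Fin d)) : S.Alg :=
  (α.map X).prod

/-- The joint spectral radius
`limsup_k max_{|α| = k} ‖X^α‖^{1/k}` with respect to `*`, computed with the maximum norm of the
entries (any other norm on the matrices gives the same value). -/
def jointSpectralRadius (S : GenSchurProduct ι κ) {d : ℕ} (X : Fin d → S.Alg) : ℝ≥0∞ :=
  Filter.limsup (fun k : ℕ =>
    (⨆ w : Fin k → Fin d, ⨆ a : ι, ⨆ b : κ,
      ‖S.toMatrix (S.monomial X (List.ofFn w)) a b‖ₑ) ^ (1 / (k : ℝ))) Filter.atTop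

/-- `X` is a Schur spectral contraction with respect to `*`: for some `A`, `B` the tuple of block
matrices `[A_i, X_i^*; X_i, B_i]` is positive definite and has joint spectral radius less than `1`
for the generalized Schur product of the direct sum of the two algebras that define `*`. -/
def IsSchurSpectralContraction (S : GenSchurProduct ι κ) {d : ℕ} (X : Fin d → S.Alg) : Prop :=
  ∃ P : SchurData ι κ, P.Presents S.mul ∧
    ∃ (A : Fin d → Matrix κ κ ℂ) (B : Fin d → Matrix ι ι ℂ),
      (∀ i, (Matrix.fromBlocks (A i) (S.toMatrix (X i)).conjTranspose
        (S.toMatrix (X i)) (B i)).PosDef) ∧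
      P.directSum.product.jointSpectralRadius
        (fun i => P.directSum.product.toMatrix.symm
          (Matrix.fromBlocks (A i) (S.toMatrix (X i)).conjTranspose
            (S.toMatrix (X i)) (B i))) < 1

/-- A generalized Schur product on square matrices is positivity preserving when the product of
two positive semi-definite matrices is positive semi-definite. -/
def PositivityPreserving {ι : Type} (S : GenSchurProduct ι ι) : Prop :=
  ∀ X Y : Matrix ι ι ℂ, X.PosSemidef → Y.PosSemidef → (S.mul X Y).PosSemidef

/-- The block matrix of an element of `M_N(ℂ) ⊗ (matrices with the product *)`. -/
def blockMatrix {N : ℕ} (S : GenSchurProduct ι κ) (F : Matrix (Fin N) (Fin N) S.Alg) :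
    Matrix (Fin N × ι) (Fin N × κ) ℂ :=
  Matrix.of fun p q => S.toMatrix (F p.1 q.1) p.2 q.2

end GenSchurProduct

/-- The `d`-dimensional generalized Schur universe: the disjoint union, over all sizes `n`, `m`
and all generalized Schur products `*` on the `n` by `m` matrices, of the sets of `d`-tuples. -/
structure SchurUniverse (d : ℕ) where
  n : ℕ
  m : ℕ
  prod : GenSchurProduct (Fin n) (Fin m)
  tuple : Fin d → prod.Alg

/-- The set of Schur spectral contractions in `d` variables. -/
def schurSpectralContractions (d : ℕ) : Set (SchurUniverse d) :=
  {x | x.prod.IsSchurSpectralContraction x.tuple}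

namespace SchurUniverse

variable {d : ℕ}

/-- The unital subalgebra generated by the entries of the tuple. -/
def generated (x : SchurUniverse d) : Subalgebra ℂ x.prod.Alg :=
  Algebra.adjoin ℂ (Set.range x.tuple)

/-- The `i`-th entry of the tuple as an element of the algebra that the tuple generates. -/
def gen (x : SchurUniverse d) (i : Fin d) : x.generated :=
  ⟨x.tuple i, Algebra.subset_adjoin (Set.mem_range_self i)⟩

/-- `f` is a scalar noncommutative function on `𝒰`; its values outside `𝒰` play no role. -/
structure IsScalarNCFunctionOn (f : (x : SchurUniverse d) → x.prod.Alg)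
    (𝒰 : Set (SchurUniverse d)) : Prop where
  mem_generated : ∀ x ∈ 𝒰, f x ∈ x.generated
  map_hom : ∀ x (hx : x ∈ 𝒰) y (hy : y ∈ 𝒰) (φ : x.generated →ₐ[ℂ] y.generated),
    (∀ i, φ (x.gen i) = y.gen i) →
      φ ⟨f x, mem_generated x hx⟩ = ⟨f y, mem_generated y hy⟩

/-- `f`, with values in the `N` by `N` matrix universe, is a noncommutative function on `𝒰`. -/
def IsNCFunctionOn {N : ℕ} (f : (x : SchurUniverse d) → Matrix (Fin N) (Fin N) x.prod.Alg)
    (𝒰 : Set (SchurUniverse d)) : Prop :=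
  ∀ p q : Fin N, IsScalarNCFunctionOn (fun x => f x p q) 𝒰

/-- `f` is positivity preserving on `𝒰`. -/
def IsPositivityPreservingOn {N : ℕ}
    (f : (x : SchurUniverse d) → Matrix (Fin N) (Fin N) x.prod.Alg)
    (𝒰 : Set (SchurUniverse d)) : Prop :=
  ∀ (n : ℕ) (S : GenSchurProduct (Fin n) (Fin n)) (X : Fin d → S.Alg),
    (⟨n, n, S, X⟩ : SchurUniverse d) ∈ 𝒰 → S.PositivityPreserving →
      (∀ i, (S.toMatrix (X i)).PosSemidef) →
        (S.blockMatrix (f ⟨n, n, S, X⟩)).PosSemidef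

end SchurUniverse

end

/-! At each point a noncommutative function is a polynomial in the tuple, but the polynomial may
change from point to point. If `y` satisfies every polynomial relation of `x`, then `x i ↦ y i`
extends to a homomorphism, so one polynomial serves both points (`IsScalarNCFunctionOn.eq_ncEval`).
The proof builds points with few relations at which positivity yields much information.

The device is inflation. Give `Matrix W W 𝒜` the entrywise coordinates coming from `v`. In the Schur
product of this algebra with itself, block diagonal matrices with blocks `Y j k` multiply as
matrices `Y` over the original Schur algebra (`blockDiag_mul`). If `T i` has nonnegative entries and
`Z i ≥ 0`, then the block diagonal matrix with blocks `T i j k • Z i` is positive, and the diagonal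
blocks of a polynomial in such matrices are `∑ p α T^α j k Z^α`. Positivity of `f` thus becomes
positivity for every single matrix entry of `T^α`. Small row sums of `T` keep the inflated tuple in
the domain (`isSchurSpectralContraction_inflate`).

Letting `T` be the shifts on words isolates each `p α Z^α`. With the scalar tuple `Z = 1/2` this
defines coefficients, independent of the truncation, and shows that they are positive.

For convergence, `T` is an automaton that counts up to `k` letters with weight `δ` and then passes
to two states with loops `1` and `b > 1`. Its entries produce positive multiples of the remainder
`R_k = ∑_{|α|>k} p α Z^α` and of `∑_{|α|>k} (b^{|α|-k-1} - 1) p α Z^α`. Both are positive, hence `0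
≤ R_k ≤ b^{-(k+1)} f(bZ)` (`posSemidef_remainders`), which tends to zero. A general contraction is
an off-diagonal block of such a positive definite `Z`, and taking that block is a homomorphism. -/

noncomputable section

/-! ### Polynomial relations and homomorphisms -/

section NCEval

variable {σ A B : Type*} [Ring A] [Algebra ℂ A] [Ring B] [Algebra ℂ B]

/-- The value at `x` of the noncommutative polynomial with coefficients `p`. -/
def ncEval (x : σ → A) : (List σ →₀ ℂ) →ₗ[ℂ] A :=
  Finsupp.linearCombination ℂ fun α => (α.map x).prod

theorem ncEval_apply (x : σ → A) (p : List σ →₀ ℂ) :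
    ncEval x p = ∑ α ∈ p.support, p α • (α.map x).prod :=
  Finsupp.linearCombination_apply ℂ p

theorem map_ncEval (φ : A →ₐ[ℂ] B) (x : σ → A) (p : List σ →₀ ℂ) :
    φ (ncEval x p) = ncEval (fun i => φ (x i)) p := by
  simp [ncEval_apply, map_sum, map_list_prod, Function.comp_def]

theorem exists_ncEval_eq {x : σ → A} {a : A} (ha : a ∈ Algebra.adjoin ℂ (Set.range x)) :
    ∃ p, ncEval x p = a := by
  have h : Subalgebra.toSubmodule (Algebra.adjoin ℂ (Set.range x)) ≤
      LinearMap.range (ncEval x) := by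
    rw [Algebra.adjoin_eq_span, Submodule.span_le]
    intro b hb
    suffices ∃ α : List σ, (α.map x).prod = b by
      obtain ⟨α, rfl⟩ := this
      exact ⟨Finsupp.single α 1, by simp [ncEval]⟩
    induction hb using Submonoid.closure_induction with
    | mem b hb =>
      obtain ⟨i, rfl⟩ := hb
      exact ⟨[i], by simp⟩
    | one => exact ⟨[], by simp⟩
    | mul b c _ _ hb hc =>
      obtain ⟨β, rfl⟩ := hb
      obtain ⟨γ, rfl⟩ := hc
      exact ⟨β ++ γ, by simp⟩
  exact h ha

/-- The homomorphism is obtained from its graph: the subalgebra of `A × B` generated by the pairs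
`(x i, y i)` projects onto `A` because `x` generates, and injectively because of the inclusion of
relations. -/
theorem exists_algHom_of_ncEval {x : σ → A} {y : σ → B}
    (hx : Algebra.adjoin ℂ (Set.range x) = ⊤)
    (h : ∀ p, ncEval x p = 0 → ncEval y p = 0) :
    ∃ φ : A →ₐ[ℂ] B, ∀ i, φ (x i) = y i := by
  let z : σ → A × B := fun i => (x i, y i)
  let G := Algebra.adjoin ℂ (Set.range z)
  let π : G →ₐ[ℂ] A := (AlgHom.fst ℂ A B).comp G.val
  have hz : ∀ i, z i ∈ G := fun i => Algebra.subset_adjoin (Set.mem_range_self i)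
  have hπ : Function.Bijective π := by
    constructor
    · rw [injective_iff_map_eq_zero]
      rintro ⟨g, hg⟩ h0
      obtain ⟨p, rfl⟩ := exists_ncEval_eq hg
      have h1 := map_ncEval (AlgHom.fst ℂ A B) z p
      have h2 := map_ncEval (AlgHom.snd ℂ A B) z p
      have h3 : ncEval x p = 0 := h1.symm.trans h0
      exact Subtype.ext (Prod.ext h0 (h2.trans (h p h3)))
    · rw [← AlgHom.range_eq_top, eq_top_iff, ← hx, Algebra.adjoin_le_iff]
      rintro _ ⟨i, rfl⟩
      exact ⟨⟨z i, hz i⟩, rfl⟩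
  refine ⟨((AlgHom.snd ℂ A B).comp G.val).comp (AlgEquiv.ofBijective π hπ).symm.toAlgHom,
    fun i => ?_⟩
  have : (AlgEquiv.ofBijective π hπ).symm (x i) = ⟨z i, hz i⟩ := by
    rw [AlgEquiv.symm_apply_eq]
    rfl
  simp [this, z]

end NCEval

/-! ### Noncommutative functions as pointwise polynomials -/

namespace SchurUniverse

variable {d : ℕ} {f : (x : SchurUniverse d) → x.prod.Alg} {𝒰 : Set (SchurUniverse d)}

theorem adjoin_range_gen (x : SchurUniverse d) :
    Algebra.adjoin ℂ (Set.range x.gen) = ⊤ := by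
  have : Set.range x.gen = Subtype.val ⁻¹' Set.range x.tuple := by
    ext ⟨a, ha⟩
    simp [gen, Subtype.ext_iff]
  rw [this]
  exact Algebra.adjoin_adjoin_coe_preimage

theorem coe_ncEval_gen (x : SchurUniverse d) (p : List (Fin d) →₀ ℂ) :
    ((ncEval x.gen p : x.generated) : x.prod.Alg) = ncEval x.tuple p :=
  map_ncEval x.generated.val x.gen p

theorem IsScalarNCFunctionOn.exists_ncEval (hf : IsScalarNCFunctionOn f 𝒰)
    {x : SchurUniverse d} (hx : x ∈ 𝒰) : ∃ p, f x = ncEval x.tuple p :=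
  (exists_ncEval_eq (hf.mem_generated x hx)).imp fun _ h => h.symm

/-- A noncommutative function is given by the same polynomial at `x` and at any tuple `y`
satisfying all polynomial relations of `x`. -/
theorem IsScalarNCFunctionOn.eq_ncEval (hf : IsScalarNCFunctionOn f 𝒰)
    {x y : SchurUniverse d} (hx : x ∈ 𝒰) (hy : y ∈ 𝒰)
    (h : ∀ p, ncEval x.tuple p = 0 → ncEval y.tuple p = 0) {p : List (Fin d) →₀ ℂ}
    (hp : f x = ncEval x.tuple p) : f y = ncEval y.tuple p := by
  obtain ⟨φ, hφ⟩ := exists_algHom_of_ncEval (y := y.gen) x.adjoin_range_gen (fun q hq => by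
    apply Subtype.ext
    rw [coe_ncEval_gen]
    refine h q ?_
    rw [← coe_ncEval_gen, hq]
    rfl)
  have h1 := hf.map_hom x hx y hy φ hφ
  have h2 : (⟨f x, hf.mem_generated x hx⟩ : x.generated) = ncEval x.gen p :=
    Subtype.ext (hp.trans (x.coe_ncEval_gen p).symm)
  rw [h2, map_ncEval] at h1
  simp only [hφ] at h1
  rw [← coe_ncEval_gen]
  exact (congrArg Subtype.val h1).symm

end SchurUniverse

section

variable {ι κ ι' κ' : Type} {𝒜 : Type} [Ring 𝒜] [Algebra ℂ 𝒜]

/-- The data given by the same algebra and the same linear bijection on both sides. -/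
def SchurData.square (v : 𝒜 ≃ₗ[ℂ] (ι → ℂ)) : SchurData ι ι where
  𝒜 := 𝒜
  ℬ := 𝒜
  vA := v
  vB := v

namespace GenSchurProduct

/-! ### Blocks of a Schur product as homomorphic images -/

section Restrict

variable [Fintype ι] [Fintype κ] [DecidableEq ι] [DecidableEq κ]
  [Fintype ι'] [Fintype κ'] [DecidableEq ι'] [DecidableEq κ']

/-- `S.one` is built from chosen data, which may differ from `P`. A two-sided identity is unique, so
any presentation may be used instead. -/
theorem one_eq_rankOne (S : GenSchurProduct ι κ) {P : SchurData ι κ} (hP : P.Presents S.mul) :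
    S.one = P.rankOne 1 1 := by
  have h : ∀ X, S.mul (P.rankOne 1 1) X = X := fun X => by
    induction X using P.rankOne_induction with
    | hadd X Y hX hY => rw [map_add, hX, hY]
    | h a b => rw [hP, one_mul, one_mul]
  rw [← h S.one, S.mul_one']

/-- The restriction of matrices to rows and columns on which the coordinates are given by algebra
homomorphisms. -/
def restrict {S' : GenSchurProduct ι' κ'} {S : GenSchurProduct ι κ} {P' : SchurData ι' κ'}
    {P : SchurData ι κ} (hP' : P'.Presents S'.mul) (hP : P.Presents S.mul)
    (φ : P'.𝒜 →ₐ[ℂ] P.𝒜) (ψ : P'.ℬ →ₐ[ℂ] P.ℬ) (r : ι → ι') (c : κ → κ')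
    (hφ : ∀ a i, P.vA (φ a) i = P'.vA a (r i)) (hψ : ∀ b j, P.vB (ψ b) j = P'.vB b (c j)) :
    S'.Alg →ₐ[ℂ] S.Alg :=
  have hr : ∀ a b, (P'.rankOne a b).submatrix r c = P.rankOne (φ a) (ψ b) := fun a b => by
    ext i j
    simp [SchurData.rankOne, Matrix.vecMulVec_apply, hφ, hψ]
  AlgHom.ofLinearMap
    { toFun := fun X => S.toMatrix.symm ((S'.toMatrix X).submatrix r c)
      map_add' := fun _ _ => rfl
      map_smul' := fun _ _ => rfl }
    (by
      change S'.one.submatrix r c = S.one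
      rw [S'.one_eq_rankOne hP', S.one_eq_rankOne hP, hr, map_one, map_one])
    (fun X Y => by
      change (S'.mul (S'.toMatrix X) (S'.toMatrix Y)).submatrix r c =
        S.mul ((S'.toMatrix X).submatrix r c) ((S'.toMatrix Y).submatrix r c)
      generalize S'.toMatrix X = X
      generalize S'.toMatrix Y = Y
      induction X using P'.rankOne_induction with
      | hadd X₁ X₂ h₁ h₂ =>
        simp only [map_add, LinearMap.add_apply, Matrix.submatrix_add, Pi.add_apply, h₁, h₂]
      | h a b =>
        induction Y using P'.rankOne_induction with
        | hadd Y₁ Y₂ h₁ h₂ => simp only [map_add, Matrix.submatrix_add, Pi.add_apply, h₁, h₂]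
        | h a' b' => rw [hP', hr, hr, hr, hP, map_mul, map_mul])

end Restrict

/-! ### The Schur product of an algebra with itself -/

section Square

variable [Fintype ι] [DecidableEq ι] [Fintype ι'] [DecidableEq ι']

/-- The generalized Schur product of an algebra with itself. -/
abbrev square (v : 𝒜 ≃ₗ[ℂ] (ι → ℂ)) : GenSchurProduct ι ι :=
  (SchurData.square v).product

theorem square_presents (v : 𝒜 ≃ₗ[ℂ] (ι → ℂ)) :
    (SchurData.square v).Presents (square v).mul :=
  (SchurData.square v).presents_mul

/-- The matrix `v(a) v(b)^*`. -/
def outer (v : 𝒜 ≃ₗ[ℂ] (ι → ℂ)) (a b : 𝒜) : (square v).Alg :=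
  (square v).toMatrix.symm (Matrix.vecMulVec (v a) (star (v b)))

theorem outer_mul_outer (v : 𝒜 ≃ₗ[ℂ] (ι → ℂ)) (a b c d : 𝒜) :
    outer v a b * outer v c d = outer v (a * c) (b * d) :=
  square_presents v a b c d

theorem outer_induction (v : 𝒜 ≃ₗ[ℂ] (ι → ℂ)) {p : (square v).Alg → Prop}
    (h : ∀ a b, p (outer v a b)) (hadd : ∀ X Y, p X → p Y → p (X + Y)) (X : (square v).Alg) :
    p X :=
  (SchurData.square v).rankOne_induction (p := p) h hadd X

theorem posSemidef_square_one (v : 𝒜 ≃ₗ[ℂ] (ι → ℂ)) : (square v).one.PosSemidef := by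
  rw [(square v).one_eq_rankOne (square_presents v)]
  exact Matrix.posSemidef_vecMulVec_self_star _

/-- A positive matrix is a sum of terms `v(a) v(a)^*`, and the product of two such terms is `v(ac)
v(ac)^*`, again of this form. -/
theorem square_positivityPreserving (v : 𝒜 ≃ₗ[ℂ] (ι → ℂ)) :
    (square v).PositivityPreserving := by
  intro X Y hX hY
  obtain ⟨m, x, rfl⟩ := Matrix.posSemidef_iff_eq_sum_vecMulVec.mp hX
  obtain ⟨n, y, rfl⟩ := Matrix.posSemidef_iff_eq_sum_vecMulVec.mp hY
  simp only [map_sum, LinearMap.sum_apply]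
  refine Matrix.posSemidef_sum _ fun i _ => Matrix.posSemidef_sum _ fun j _ => ?_
  have h : ∀ z : ι → ℂ, Matrix.vecMulVec z (star z) = outer v (v.symm z) (v.symm z) := fun z => by
    rw [outer, LinearEquiv.apply_symm_apply]
    rfl
  have h2 := outer_mul_outer v (v.symm (x j)) (v.symm (x j)) (v.symm (y i)) (v.symm (y i))
  rw [h, h]
  change ((square v).toMatrix (outer v _ _ * outer v _ _)).PosSemidef
  rw [h2]
  exact Matrix.posSemidef_vecMulVec_self_star _

theorem posSemidef_monomial {S : GenSchurProduct ι ι} (hS : S.PositivityPreserving)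
    (h1 : S.one.PosSemidef) {d : ℕ} {X : Fin d → S.Alg}
    (hX : ∀ i, (S.toMatrix (X i)).PosSemidef) (α : List (Fin d)) :
    (S.toMatrix (S.monomial X α)).PosSemidef := by
  induction α with
  | nil => exact h1
  | cons i α ih => exact hS _ _ (hX i) ih

end Square

/-! ### Inflation: matrices over a Schur algebra as block diagonal matrices -/

section BlockDiag

variable [Fintype ι] [DecidableEq ι] [Fintype ι'] [DecidableEq ι']
  {W : Type} [Fintype W] [DecidableEq W]

/-- Entrywise coordinates on the algebra of matrices over `𝒜`. -/
def matrixCoords (v : 𝒜 ≃ₗ[ℂ] (ι → ℂ)) (e : ι' ≃ (W × W) × ι) :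
    Matrix W W 𝒜 ≃ₗ[ℂ] (ι' → ℂ) where
  toFun M i := v (M (e i).1.1 (e i).1.2) (e i).2
  map_add' M M' := by ext; simp
  map_smul' c M := by ext; simp
  invFun z j k := v.symm fun a => z (e.symm ((j, k), a))
  left_inv M := by ext j k; simp
  right_inv z := by ext i; simp

omit [Fintype ι] [DecidableEq ι] [Fintype ι'] [DecidableEq ι'] [Fintype W] [DecidableEq W] in
theorem matrixCoords_apply (v : 𝒜 ≃ₗ[ℂ] (ι → ℂ)) (e : ι' ≃ (W × W) × ι) (M : Matrix W W 𝒜)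
    (i : ι') : matrixCoords v e M i = v (M (e i).1.1 (e i).1.2) (e i).2 := rfl

variable (v : 𝒜 ≃ₗ[ℂ] (ι → ℂ)) (e : ι' ≃ (W × W) × ι)

/-- The block diagonal matrix, over the product of the matrix algebra with itself, whose blocks
are the entries of a matrix over the product of `𝒜` with itself. -/
def blockDiag : Matrix W W (square v).Alg →ₗ[ℂ] (square (matrixCoords v e)).Alg where
  toFun Y := (square (matrixCoords v e)).toMatrix.symm (Matrix.of fun i j =>
    if (e i).1 = (e j).1 then
      (square v).toMatrix (Y (e i).1.1 (e i).1.2) (e i).2 (e j).2 else 0)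
  map_add' Y Y' := by
    rw [← map_add]
    congr 1
    ext i j
    by_cases h : (e i).1 = (e j).1 <;> simp [h]
  map_smul' c Y := by
    rw [← map_smul]
    congr 1
    ext i j
    by_cases h : (e i).1 = (e j).1 <;> simp [h]

theorem blockDiag_apply (Y : Matrix W W (square v).Alg) (i j : ι') :
    (square (matrixCoords v e)).toMatrix (blockDiag v e Y) i j =
      if (e i).1 = (e j).1 then
        (square v).toMatrix (Y (e i).1.1 (e i).1.2) (e i).2 (e j).2 else 0 := rfl

/-- With entrywise coordinates, the vector of a matrix supported at `(j, k)` lives in one block, so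
its outer products occupy a single diagonal block. -/
theorem blockDiag_single_outer (j k : W) (a b : 𝒜) :
    blockDiag v e (Matrix.single j k (outer v a b)) =
      outer (matrixCoords v e) (Matrix.single j k a) (Matrix.single j k b) := by
  apply (square (matrixCoords v e)).toMatrix.injective
  ext i i'
  rw [blockDiag_apply]
  change _ = matrixCoords v e (Matrix.single j k a) i *
    star (matrixCoords v e (Matrix.single j k b) i')
  rw [matrixCoords_apply, matrixCoords_apply, Matrix.single_apply, Matrix.single_apply,
    Matrix.single_apply]
  by_cases h : j = (e i).1.1 ∧ k = (e i).1.2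
  · by_cases h' : j = (e i').1.1 ∧ k = (e i').1.2
    · have : (e i).1 = (e i').1 := Prod.ext (h.1.symm.trans h'.1) (h.2.symm.trans h'.2)
      rw [if_pos this, if_pos h, if_pos h, if_pos h']
      rfl
    · have : (e i).1 ≠ (e i').1 := fun h0 => h' (h0 ▸ h)
      rw [if_neg this, if_neg h']
      simp
  · rw [if_neg h, if_neg h]
    simp

/-- By bilinearity this is the matrix unit rule for `single j k (outer v a b)`. The map is
multiplicative but in general not unital. -/
theorem blockDiag_mul (Y Y' : Matrix W W (square v).Alg) :
    blockDiag v e (Y * Y') = blockDiag v e Y * blockDiag v e Y' := by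
  have key : ∀ (j k l m : W) (R R' : (square v).Alg),
      blockDiag v e (Matrix.single j k R * Matrix.single l m R') =
        blockDiag v e (Matrix.single j k R) * blockDiag v e (Matrix.single l m R') := by
    intro j k l m R R'
    induction R using outer_induction with
    | hadd R₁ R₂ h₁ h₂ => simp only [map_add, Matrix.single_add, add_mul, h₁, h₂]
    | h a b =>
      induction R' using outer_induction with
      | hadd R₁ R₂ h₁ h₂ => simp only [map_add, Matrix.single_add, mul_add, h₁, h₂]
      | h a' b' =>
        rw [blockDiag_single_outer, blockDiag_single_outer, outer_mul_outer]
        by_cases hkl : k = l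
        · subst hkl
          rw [Matrix.single_mul_single_same, outer_mul_outer, blockDiag_single_outer,
            Matrix.single_mul_single_same, Matrix.single_mul_single_same]
        · rw [Matrix.single_mul_single_of_ne (h := hkl), map_zero,
            Matrix.single_mul_single_of_ne (h := hkl)]
          apply (square (matrixCoords v e)).toMatrix.injective
          ext i i'
          simp [outer]
  conv_lhs => rw [Matrix.matrix_eq_sum_single Y, Matrix.matrix_eq_sum_single Y']
  conv_rhs => rw [Matrix.matrix_eq_sum_single Y, Matrix.matrix_eq_sum_single Y']
  simp only [map_sum, Finset.sum_mul, Finset.mul_sum, key]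

end BlockDiag
end GenSchurProduct

end

section

variable {ι κ ι' κ' : Type} {𝒜 : Type} [Ring 𝒜] [Algebra ℂ 𝒜]

namespace GenSchurProduct

/-! ### Joint spectral radius and geometric decay of monomials -/

section Radius

variable [Fintype ι] [Fintype κ] [DecidableEq ι] [DecidableEq κ] {d : ℕ}

theorem jointSpectralRadius_lt_one (S : GenSchurProduct ι κ) {X : Fin d → S.Alg} {C r : ℝ}
    (hr : 0 ≤ r) (hr1 : r < 1)
    (h : ∀ α a b, ‖S.toMatrix (S.monomial X α) a b‖ ≤ C * r ^ α.length) :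
    S.jointSpectralRadius X < 1 := by
  obtain ⟨s, hrs, hs1⟩ := exists_between hr1
  have hs : 0 < s := hr.trans_lt hrs
  have hlim : Filter.Tendsto (fun k : ℕ => C * (r / s) ^ k) Filter.atTop (nhds (C * 0)) :=
    (tendsto_pow_atTop_nhds_zero_of_lt_one (by positivity) ((div_lt_one hs).2 hrs)).const_mul C
  rw [mul_zero] at hlim
  have hev := (hlim.eventually_le_const zero_lt_one).and (Filter.eventually_gt_atTop 0)
  refine (Filter.limsup_le_of_le (by isBoundedDefault) (hev.mono ?_)).trans_lt
    (ENNReal.ofReal_lt_one.2 hs1)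
  rintro k ⟨hk, hk0⟩
  rw [one_div, ENNReal.rpow_inv_le_iff (by exact_mod_cast hk0), ENNReal.rpow_natCast,
    ← ENNReal.ofReal_pow hs.le]
  refine iSup_le fun w => iSup_le fun a => iSup_le fun b => ?_
  rw [← ofReal_norm]
  refine ENNReal.ofReal_le_ofReal ((h _ a b).trans ?_)
  rw [List.length_ofFn]
  rw [div_pow, mul_div_assoc', div_le_one (by positivity)] at hk
  exact hk

theorem exists_norm_monomial_le (S : GenSchurProduct ι κ) {X : Fin d → S.Alg}
    (h : S.jointSpectralRadius X < 1) :
    ∃ C r : ℝ, 0 < r ∧ r < 1 ∧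
      ∀ α a b, ‖S.toMatrix (S.monomial X α) a b‖ ≤ C * r ^ α.length := by
  obtain ⟨s, hs, hs1⟩ := ENNReal.lt_iff_exists_nnreal_btwn.1 h
  have hev := Filter.eventually_lt_of_limsup_lt hs
  obtain ⟨K, hK⟩ := Filter.eventually_atTop.1 (hev.and (Filter.eventually_gt_atTop 0))
  -- The bound `s` may be zero; `1 / 2` keeps the rate positive, so that the finitely many monomials
  -- shorter than `K` can be absorbed into the constant.
  set r : ℝ := max s (1 / 2) with hr
  have hr0 : 0 < r := lt_max_of_lt_right (by norm_num)
  have hr1 : r < 1 := max_lt (by exact_mod_cast hs1) (by norm_num)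
  have hfin : ((fun q : List (Fin d) × ι × κ => ‖S.toMatrix (S.monomial X q.1) q.2.1 q.2.2‖) ''
      ({α | α.length < K} ×ˢ Set.univ)).Finite :=
    ((List.finite_length_lt (Fin d) K).prod Set.finite_univ).image _
  obtain ⟨M, hM⟩ := hfin.bddAbove
  refine ⟨max 1 (M / r ^ K), r, hr0, hr1, fun α a b => ?_⟩
  rcases lt_or_ge α.length K with hα | hα
  · have h1 : ‖S.toMatrix (S.monomial X α) a b‖ ≤ M := hM ⟨(α, a, b), ⟨hα, trivial⟩, rfl⟩
    have hM0 : 0 ≤ M := (norm_nonneg _).trans h1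
    calc _ ≤ M := h1
      _ = M / r ^ K * r ^ K := by field_simp
      _ ≤ max 1 (M / r ^ K) * r ^ α.length :=
        mul_le_mul (le_max_right _ _) (pow_le_pow_of_le_one hr0.le hr1.le hα.le)
          (by positivity) (by positivity)
  · obtain ⟨h1, h0⟩ := hK _ hα
    rw [one_div] at h1
    replace h1 := (ENNReal.rpow_inv_le_iff (by exact_mod_cast h0)).1 h1.le
    have h2 : ‖S.toMatrix (S.monomial X α) a b‖ₑ ≤ (s : ℝ≥0∞) ^ α.length := by
      rw [ENNReal.rpow_natCast] at h1
      refine le_trans ?_ h1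
      have h3 : List.ofFn α.get = α := List.ofFn_get α
      refine le_trans ?_ (le_iSup _ α.get)
      rw [h3]
      exact (le_iSup (fun b => ‖S.toMatrix (S.monomial X α) a b‖ₑ) b).trans (le_iSup
        (fun a => ⨆ b, ‖S.toMatrix (S.monomial X α) a b‖ₑ) a)
    have h3 : ‖S.toMatrix (S.monomial X α) a b‖ ≤ (s : ℝ) ^ α.length := by
      rw [← enorm_norm, Real.enorm_eq_ofReal (norm_nonneg _), ← ENNReal.coe_pow,
        ENNReal.ofReal_le_coe] at h2
      exact_mod_cast h2
    calc _ ≤ (s : ℝ) ^ α.length := h3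
      _ ≤ r ^ α.length := by gcongr; exact le_max_left _ _
      _ ≤ max 1 (M / r ^ K) * r ^ α.length :=
        le_mul_of_one_le_left (by positivity) (le_max_left _ _)

theorem map_monomial [Fintype ι'] [Fintype κ'] [DecidableEq ι'] [DecidableEq κ']
    {S : GenSchurProduct ι κ} {S' : GenSchurProduct ι' κ'} (φ : S'.Alg →ₐ[ℂ] S.Alg)
    (X : Fin d → S'.Alg) (α : List (Fin d)) :
    φ (S'.monomial X α) = S.monomial (fun i => φ (X i)) α := by
  simp [monomial, map_list_prod, Function.comp_def]

end Radius

/-! ### Monomials, norms and positivity of inflated tuples -/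

section Inflate

variable [Fintype ι] [DecidableEq ι] [Fintype ι'] [DecidableEq ι']
  {W : Type} [Fintype W] [DecidableEq W] (v : 𝒜 ≃ₗ[ℂ] (ι → ℂ)) (e : ι' ≃ (W × W) × ι) {d : ℕ}

/-- The block diagonal matrix whose blocks are the multiples of `z` by the entries of `T`. -/
def inflate (T : Matrix W W ℂ) (z : (square v).Alg) : (square (matrixCoords v e)).Alg :=
  blockDiag v e (T.map (· • z))

theorem toMatrix_inflate (T : Matrix W W ℂ) (z : (square v).Alg) :
    (square (matrixCoords v e)).toMatrix (inflate v e T z) =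
      ((Matrix.diagonal fun w : W × W => T w.1 w.2) ⊗ₖ (square v).toMatrix z).submatrix e e := by
  ext i j
  rw [inflate, blockDiag_apply, Matrix.submatrix_apply, Matrix.kroneckerMap_apply,
    Matrix.diagonal_apply]
  split_ifs <;> simp

theorem inflate_mul (T T' : Matrix W W ℂ) (z z' : (square v).Alg) :
    inflate v e (T * T') (z * z') = inflate v e T z * inflate v e T' z' := by
  rw [inflate, inflate, inflate, ← blockDiag_mul]
  congr 1
  ext j k
  simp only [Matrix.mul_apply, Matrix.map_apply, Finset.sum_smul, smul_mul_smul_comm]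

theorem inflate_add (T T' : Matrix W W ℂ) (z : (square v).Alg) :
    inflate v e (T + T') z = inflate v e T z + inflate v e T' z := by
  rw [inflate, inflate, inflate, ← map_add]
  congr 1
  ext j k
  simp [add_smul]

theorem inflate_smul_right (c : ℂ) (T : Matrix W W ℂ) (z : (square v).Alg) :
    inflate v e T (c • z) = c • inflate v e T z := by
  rw [inflate, inflate, ← map_smul]
  congr 1
  ext j k
  simp [smul_comm c]

/-- The empty word is excluded: the identity `v(1) v(1)^*` of the large product also has blocks
linking `(j, j)` to `(k, k)` for `j ≠ k`, so it need not be block diagonal. -/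
theorem monomial_inflate (T : Fin d → Matrix W W ℂ) (Z : Fin d → (square v).Alg)
    {α : List (Fin d)} (hα : α ≠ []) :
    (square (matrixCoords v e)).monomial (fun i => inflate v e (T i) (Z i)) α =
      inflate v e (α.map T).prod ((square v).monomial Z α) := by
  induction α with
  | nil => exact absurd rfl hα
  | cons i α ih =>
    rcases eq_or_ne α [] with rfl | h
    · simp [monomial]
    · have := ih h
      simp only [monomial, List.map_cons, List.prod_cons] at this ⊢
      rw [this, inflate_mul]

/-- The diagonal blocks do not see the off-diagonal part of the identity, so here the formula covers
the empty word too. -/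
theorem toMatrix_monomial_inflate_apply (T : Fin d → Matrix W W ℂ) (Z : Fin d → (square v).Alg)
    (α : List (Fin d)) (w : W × W) (a b : ι) :
    (square (matrixCoords v e)).toMatrix
        ((square (matrixCoords v e)).monomial (fun i => inflate v e (T i) (Z i)) α)
        (e.symm (w, a)) (e.symm (w, b)) =
      (α.map T).prod w.1 w.2 * (square v).toMatrix ((square v).monomial Z α) a b := by
  rcases eq_or_ne α [] with rfl | h
  · change (square (matrixCoords v e)).one _ _ = (1 : Matrix W W ℂ) _ _ * (square v).one _ _
    rw [one_eq_rankOne _ (square_presents _), one_eq_rankOne _ (square_presents _)]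
    change matrixCoords v e 1 _ * star (matrixCoords v e 1 _) = _ * (v 1 a * star (v 1 b))
    rw [matrixCoords_apply, matrixCoords_apply]
    simp only [Equiv.apply_symm_apply, Matrix.one_apply]
    split_ifs <;> simp
  · rw [monomial_inflate v e T Z h, toMatrix_inflate]
    simp

/-- The maximal row sum is a submultiplicative norm. -/
theorem norm_list_prod_row_le {T : Fin d → Matrix W W ℂ} {ρ : ℝ}
    (hT : ∀ i j, ∑ k, ‖T i j k‖ ≤ ρ) (α : List (Fin d)) (j : W) :
    ∑ k, ‖(α.map T).prod j k‖ ≤ ρ ^ α.length := by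
  induction α generalizing j with
  | nil => simp [Matrix.one_apply, apply_ite norm]
  | cons i α ih =>
    have hρ : 0 ≤ ρ := (Finset.sum_nonneg fun k _ => norm_nonneg _).trans (hT i j)
    rw [List.map_cons, List.prod_cons, List.length_cons, pow_succ']
    calc ∑ k, ‖(T i * (α.map T).prod) j k‖
        ≤ ∑ k, ∑ l, ‖T i j l‖ * ‖(α.map T).prod l k‖ := by
          refine Finset.sum_le_sum fun k _ => ?_
          rw [Matrix.mul_apply]
          exact (norm_sum_le _ _).trans_eq (by simp)
      _ = ∑ l, ‖T i j l‖ * ∑ k, ‖(α.map T).prod l k‖ := by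
          rw [Finset.sum_comm]
          simp [Finset.mul_sum]
      _ ≤ ∑ l, ‖T i j l‖ * ρ ^ α.length := by
          gcongr with l
          exact ih l
      _ ≤ ρ * ρ ^ α.length := by
          rw [← Finset.sum_mul]
          gcongr
          exact hT i j

theorem norm_monomial_inflate_le {T : Fin d → Matrix W W ℂ} {ρ : ℝ}
    (hT : ∀ i j, ∑ k, ‖T i j k‖ ≤ ρ) {Z : Fin d → (square v).Alg} {C r : ℝ} (hr : 0 ≤ r)
    (hZ : ∀ α a b, ‖(square v).toMatrix ((square v).monomial Z α) a b‖ ≤ C * r ^ α.length) :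
    ∃ C', ∀ α a b, ‖(square (matrixCoords v e)).toMatrix ((square (matrixCoords v e)).monomial
      (fun i => inflate v e (T i) (Z i)) α) a b‖ ≤ C' * (ρ * r) ^ α.length := by
  obtain ⟨M, hM⟩ := (Set.finite_range fun q : ι' × ι' =>
    ‖(square (matrixCoords v e)).one q.1 q.2‖).bddAbove
  -- `M` bounds the identity, the one monomial not covered by the block diagonal formula.
  refine ⟨max M C, fun α a b => ?_⟩
  rcases eq_or_ne α [] with rfl | h
  · rw [List.length_nil, pow_zero, mul_one]
    exact (hM ⟨(a, b), rfl⟩).trans (le_max_left M C)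
  · have hC : 0 ≤ C := by simpa using (norm_nonneg _).trans (hZ [] (e a).2 (e b).2)
    obtain ⟨i, -⟩ := List.exists_mem_of_ne_nil α h
    have hρ : 0 ≤ ρ :=
      (Finset.sum_nonneg fun k _ => norm_nonneg _).trans (hT i (e a).1.1)
    have h1 : ‖(α.map T).prod (e a).1.1 (e a).1.2‖ ≤ ρ ^ α.length :=
      (Finset.single_le_sum (f := fun k => ‖(α.map T).prod (e a).1.1 k‖)
        (fun k _ => norm_nonneg _) (Finset.mem_univ _)).trans (norm_list_prod_row_le hT α _)
    rw [monomial_inflate v e T Z h, toMatrix_inflate, Matrix.submatrix_apply,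
      Matrix.kroneckerMap_apply, norm_mul, Matrix.diagonal_apply]
    calc _ ≤ ρ ^ α.length * (C * r ^ α.length) := by
          gcongr
          · split_ifs
            · exact h1
            · simpa using pow_nonneg hρ _
          · exact hZ α _ _
      _ = C * (ρ * r) ^ α.length := by ring
      _ ≤ _ := by
          gcongr
          exact le_max_right _ _

variable {v e}

theorem posSemidef_inflate {T : Matrix W W ℂ} (hT : ∀ j k, 0 ≤ T j k) {z : (square v).Alg}
    (hz : ((square v).toMatrix z).PosSemidef) :
    ((square (matrixCoords v e)).toMatrix (inflate v e T z)).PosSemidef := by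
  rw [toMatrix_inflate]
  have h : (Matrix.diagonal fun w : W × W => T w.1 w.2).PosSemidef :=
    Matrix.PosSemidef.diagonal fun w => hT w.1 w.2
  exact (h.kronecker hz).submatrix e

theorem posDef_inflate {T : Matrix W W ℂ} (hT : ∀ j k, 0 < T j k) {z : (square v).Alg}
    (hz : ((square v).toMatrix z).PosDef) :
    ((square (matrixCoords v e)).toMatrix (inflate v e T z)).PosDef := by
  rw [toMatrix_inflate]
  have h : (Matrix.diagonal fun w : W × W => T w.1 w.2).PosDef :=
    Matrix.PosDef.diagonal fun w => hT w.1 w.2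
  exact (h.kronecker hz).submatrix e.injective

end Inflate
end GenSchurProduct

end

section

variable {ι κ ι' κ' : Type} {𝒜 : Type} [Ring 𝒜] [Algebra ℂ 𝒜]

namespace GenSchurProduct

/-! ### A criterion for positive tuples to be spectral contractions -/

section DirectSum

variable [Fintype ι] [DecidableEq ι] {d : ℕ} (v : 𝒜 ≃ₗ[ℂ] (ι → ℂ))

/-- The coordinate projection of the direct sum of two copies of an algebra. -/
def directSumProj (s : Bool) : 𝒜 × 𝒜 →ₐ[ℂ] 𝒜 :=
  if s then AlgHom.fst ℂ 𝒜 𝒜 else AlgHom.snd ℂ 𝒜 𝒜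

/-- A block of a matrix over the direct sum of two copies of an algebra. -/
def directSumBlock (s t : Bool) :
    (SchurData.square v).directSum.product.Alg →ₐ[ℂ] (square v).Alg :=
  restrict (SchurData.square v).directSum.presents_mul (square_presents v)
    (directSumProj s) (directSumProj t)
    (if s then Sum.inl else Sum.inr) (if t then Sum.inl else Sum.inr)
    (by cases s <;> exact fun _ _ => rfl) (by cases t <;> exact fun _ _ => rfl)

theorem toMatrix_directSumBlock (s t : Bool) (X : (SchurData.square v).directSum.product.Alg) :
    (square v).toMatrix (directSumBlock v s t X) =
      ((SchurData.square v).directSum.product.toMatrix X).submatrix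
        (if s then Sum.inl else Sum.inr) (if t then Sum.inl else Sum.inr) := rfl

theorem toMatrix_monomial_fromBlocks (A X Y B : Fin d → (square v).Alg) (α : List (Fin d)) :
    (SchurData.square v).directSum.product.toMatrix
      ((SchurData.square v).directSum.product.monomial (fun i =>
        (SchurData.square v).directSum.product.toMatrix.symm (Matrix.fromBlocks
          ((square v).toMatrix (A i)) ((square v).toMatrix (X i)) ((square v).toMatrix (Y i))
          ((square v).toMatrix (B i)))) α) =
    Matrix.fromBlocks
      ((square v).toMatrix ((square v).monomial A α)) ((square v).toMatrix ((square v).monomial X α))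
      ((square v).toMatrix ((square v).monomial Y α))
      ((square v).toMatrix ((square v).monomial B α)) := by
  set Z : Fin d → (SchurData.square v).directSum.product.Alg := fun i =>
        (SchurData.square v).directSum.product.toMatrix.symm (Matrix.fromBlocks
          ((square v).toMatrix (A i)) ((square v).toMatrix (X i)) ((square v).toMatrix (Y i))
          ((square v).toMatrix (B i)))
  have h : ∀ s t, (square v).toMatrix ((square v).monomial (fun i => directSumBlock v s t (Z i)) α)
      = ((SchurData.square v).directSum.product.toMatrix
        ((SchurData.square v).directSum.product.monomial Z α)).submatrix
        (if s then Sum.inl else Sum.inr) (if t then Sum.inl else Sum.inr) := fun s t => by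
    rw [← toMatrix_directSumBlock, map_monomial]
  have h11 := h true true
  have h12 := h true false
  have h21 := h false true
  have h22 := h false false
  ext (a | a) (b | b)
  · exact (congrFun (congrFun h11 a) b).symm
  · exact (congrFun (congrFun h12 a) b).symm
  · exact (congrFun (congrFun h21 a) b).symm
  · exact (congrFun (congrFun h22 a) b).symm

/-- Take `A` for both diagonal blocks: `[A, X; X, A]` is the positive matrix `[X, X; X, X]` plus the
positive definite `diag(A - X, A - X)`. The direct sum product acts block by block, so the radius is
controlled by the monomials of `A` and `X`. -/
theorem isSchurSpectralContraction_of_norm_le {A X : Fin d → (square v).Alg}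
    (hX : ∀ i, ((square v).toMatrix (X i)).PosSemidef)
    (hA : ∀ i, ((square v).toMatrix (A i - X i)).PosDef)
    {C r : ℝ} (hr : 0 ≤ r) (hr1 : r < 1)
    (hAC : ∀ α a b, ‖(square v).toMatrix ((square v).monomial A α) a b‖ ≤ C * r ^ α.length)
    (hXC : ∀ α a b, ‖(square v).toMatrix ((square v).monomial X α) a b‖ ≤ C * r ^ α.length) :
    (square v).IsSchurSpectralContraction X := by
  refine ⟨SchurData.square v, square_presents v, fun i => (square v).toMatrix (A i),
    fun i => (square v).toMatrix (A i), fun i => ?_, ?_⟩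
  · rw [(hX i).isHermitian.eq]
    have h1 : (((square v).toMatrix (X i)).submatrix (Sum.elim id id : ι ⊕ ι → ι)
        (Sum.elim id id)).PosSemidef := (hX i).submatrix _
    have h2 : ((1 : Matrix Bool Bool ℂ) ⊗ₖ ((square v).toMatrix (A i - X i))).PosDef :=
      Matrix.PosDef.one.kronecker (hA i)
    have h3 : Function.Injective
        (Sum.elim (fun a => (true, a)) (fun a => (false, a)) : ι ⊕ ι → Bool × ι) := by
      rintro (a | a) (b | b) h <;> simp_all
    convert Matrix.PosDef.posSemidef_add h1 (h2.submatrix h3) using 1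
    ext (a | a) (b | b) <;> simp
  · refine jointSpectralRadius_lt_one _ (C := C) hr hr1 fun α => ?_
    have := toMatrix_monomial_fromBlocks v A X X A α
    simp only [(hX _).isHermitian.eq]
    rw [this]
    rintro (a | a) (b | b)
    exacts [hAC α a b, hXC α a b, hXC α a b, hAC α a b]

end DirectSum

section Inflate

variable [Fintype ι] [DecidableEq ι] [Fintype ι'] [DecidableEq ι']
  {W : Type} [Fintype W] [DecidableEq W] {v : 𝒜 ≃ₗ[ℂ] (ι → ℂ)} (e : ι' ≃ (W × W) × ι) {d : ℕ}

/-- The dominating tuple inflates `T i + E` with `E` a small positive constant matrix. The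
difference, inflated from `E`, is positive definite even where `T i` has zeros, and the row sums
remain below some `ρ'` with `ρ' * r < 1`. -/
theorem isSchurSpectralContraction_inflate {T : Fin d → Matrix W W ℂ}
    (hT : ∀ i j k, 0 ≤ T i j k) {ρ : ℝ} (hρ : 0 ≤ ρ) (hTρ : ∀ i j, ∑ k, ‖T i j k‖ ≤ ρ)
    {Z : Fin d → (square v).Alg} (hZ : ∀ i, ((square v).toMatrix (Z i)).PosDef)
    {C r : ℝ} (hr : 0 < r) (hρr : ρ * r < 1)
    (hZC : ∀ α a b, ‖(square v).toMatrix ((square v).monomial Z α) a b‖ ≤ C * r ^ α.length) :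
    (square (matrixCoords v e)).IsSchurSpectralContraction
      (fun i => inflate v e (T i) (Z i)) := by
  obtain ⟨ρ', hρρ', hρ'⟩ := exists_between ((lt_div_iff₀ hr).2 hρr)
  rw [lt_div_iff₀ hr] at hρ'
  have hρ'0 : 0 ≤ ρ' := hρ.trans hρρ'.le
  -- Adding `η` to each entry of a row costs at most `ρ' - ρ`; the `+ 1` avoids division by zero for
  -- empty `W`.
  set η : ℝ := (ρ' - ρ) / (Fintype.card W + 1) with hη
  have hη0 : 0 < η := div_pos (sub_pos.2 hρρ') (by positivity)
  have hη1 : Fintype.card W * η ≤ ρ' - ρ := by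
    rw [hη, mul_div_assoc', div_le_iff₀ (by positivity)]
    nlinarith
  let E : Matrix W W ℂ := Matrix.of fun _ _ => (η : ℂ)
  have hE : ∀ i j, ∑ k, ‖(T i + E) j k‖ ≤ ρ' := fun i j => by
    calc ∑ k, ‖(T i + E) j k‖ ≤ ∑ k, (‖T i j k‖ + η) := Finset.sum_le_sum fun k _ => by
          refine (norm_add_le _ _).trans_eq ?_
          simp [E, abs_of_pos hη0]
      _ = ∑ k, ‖T i j k‖ + Fintype.card W * η := by simp [Finset.sum_add_distrib]
      _ ≤ ρ' := by linarith [hTρ i j]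
  obtain ⟨C₁, h₁⟩ := norm_monomial_inflate_le v e hE hr.le hZC
  obtain ⟨C₂, h₂⟩ := norm_monomial_inflate_le v e (fun i j => (hTρ i j).trans hρρ'.le) hr.le hZC
  refine isSchurSpectralContraction_of_norm_le (A := fun i => inflate v e (T i + E) (Z i))
    (C := max C₁ C₂) (r := ρ' * r) _
    (fun i => posSemidef_inflate (hT i) (hZ i).posSemidef) (fun i => ?_) (by positivity) hρ'
    (fun α a b => (h₁ α a b).trans ?_) (fun α a b => (h₂ α a b).trans ?_)
  · rw [inflate_add, add_sub_cancel_left]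
    exact posDef_inflate (fun _ _ => by simpa [E] using hη0) (hZ i)
  · gcongr
    exact le_max_left _ _
  · gcongr
    exact le_max_right _ _

end Inflate
end GenSchurProduct

end

section

variable {ι κ ι' κ' : Type} {𝒜 : Type} [Ring 𝒜] [Algebra ℂ 𝒜]

namespace GenSchurProduct

/-- A Schur spectral contraction is an off-diagonal block of a positive definite tuple with
exponentially decaying monomials, for the product of an algebra with itself. -/
theorem IsSchurSpectralContraction.exists_square [Fintype ι] [DecidableEq ι] [Fintype κ]
    [DecidableEq κ] {S : GenSchurProduct ι κ} {d : ℕ} {X : Fin d → S.Alg}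
    (h : S.IsSchurSpectralContraction X) :
    ∃ (𝒜 : Type) (_ : Ring 𝒜) (_ : Algebra ℂ 𝒜) (v : 𝒜 ≃ₗ[ℂ] (κ ⊕ ι → ℂ))
      (Z : Fin d → (square v).Alg) (φ : (square v).Alg →ₐ[ℂ] S.Alg) (C r : ℝ),
      (∀ F a b, S.toMatrix (φ F) a b = (square v).toMatrix F (Sum.inr a) (Sum.inl b)) ∧
      (∀ i, φ (Z i) = X i) ∧ (∀ i, ((square v).toMatrix (Z i)).PosDef) ∧ 0 < r ∧ r < 1 ∧
      ∀ α a b, ‖(square v).toMatrix ((square v).monomial Z α) a b‖ ≤ C * r ^ α.length := by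
  obtain ⟨P, hP, A, B, hpos, hrad⟩ := h
  obtain ⟨C, r, hr, hr1, hC⟩ := exists_norm_monomial_le _ hrad
  let φ : P.directSum.product.Alg →ₐ[ℂ] S.Alg :=
    restrict P.directSum.presents_mul hP (AlgHom.snd ℂ P.ℬ P.𝒜) (AlgHom.fst ℂ P.ℬ P.𝒜)
      Sum.inr Sum.inl (fun _ _ => rfl) (fun _ _ => rfl)
  exact ⟨P.ℬ × P.𝒜, inferInstance, inferInstance, P.directSum.vA,
    fun i => P.directSum.product.toMatrix.symm (Matrix.fromBlocks (A i)
      (S.toMatrix (X i)).conjTranspose (S.toMatrix (X i)) (B i)), φ, C, r, fun _ _ _ => rfl,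
    fun i => rfl, hpos, hr, hr1, hC⟩

/-! ### Inflated points and the diagonal blocks of their polynomials -/

section Sample

variable [Fintype ι] [DecidableEq ι] {W : Type} [Fintype W] [DecidableEq W] {d : ℕ}
  (v : 𝒜 ≃ₗ[ℂ] (ι → ℂ)) (T : Fin d → Matrix W W ℂ) (Z : Fin d → (square v).Alg)

variable (ι W) in
/-- The enumeration of the rows of the inflated matrices. -/
def inflateIndex : Fin (Fintype.card ((W × W) × ι)) ≃ (W × W) × ι :=
  (Fintype.equivFin ((W × W) × ι)).symm

/-- The tuple of inflated matrices as a point of the universe. -/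
abbrev inflatePoint : SchurUniverse d where
  n := Fintype.card ((W × W) × ι)
  m := Fintype.card ((W × W) × ι)
  prod := square (matrixCoords v (inflateIndex ι W))
  tuple i := inflate v (inflateIndex ι W) (T i) (Z i)

/-- A diagonal block of a matrix with entries in the algebra of an inflated point. -/
def diagBlock {N : ℕ} (F : Matrix (Fin N) (Fin N) (inflatePoint v T Z).prod.Alg) (w : W × W) :
    Matrix (Fin N × ι) (Fin N × ι) ℂ :=
  ((inflatePoint v T Z).prod.blockMatrix F).submatrix
    (fun q => (q.1, (inflateIndex ι W).symm (w, q.2)))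
    (fun q => (q.1, (inflateIndex ι W).symm (w, q.2)))

theorem toMatrix_ncEval_inflatePoint (p : List (Fin d) →₀ ℂ) (w : W × W) (a b : ι) :
    (inflatePoint v T Z).prod.toMatrix (ncEval (inflatePoint v T Z).tuple p)
        ((inflateIndex ι W).symm (w, a)) ((inflateIndex ι W).symm (w, b)) =
      ∑ α ∈ p.support, p α * ((α.map T).prod w.1 w.2 *
        (square v).toMatrix ((square v).monomial Z α) a b) := by
  rw [ncEval_apply, map_sum, Matrix.sum_apply]
  refine Finset.sum_congr rfl fun α _ => ?_
  rw [map_smul, Matrix.smul_apply, smul_eq_mul,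
    ← toMatrix_monomial_inflate_apply v (inflateIndex ι W)]
  rfl

theorem diagBlock_apply {N : ℕ} {F : Matrix (Fin N) (Fin N) (inflatePoint v T Z).prod.Alg}
    {p : List (Fin d) →₀ ℂ} {s t : Fin N}
    (hF : F s t = ncEval (inflatePoint v T Z).tuple p) (w : W × W) (a b : ι) :
    diagBlock v T Z F w (s, a) (t, b) =
      ∑ α ∈ p.support, p α * ((α.map T).prod w.1 w.2 *
        (square v).toMatrix ((square v).monomial Z α) a b) := by
  rw [← toMatrix_ncEval_inflatePoint, ← hF]
  rfl

/-- The diagonal blocks of a polynomial relation of inflated matrices. -/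
theorem sum_eq_zero_of_ncEval_eq_zero {p : List (Fin d) →₀ ℂ}
    (hp : ncEval (inflatePoint v T Z).tuple p = 0) (w : W × W) :
    ∑ α ∈ p.support, (p α * (α.map T).prod w.1 w.2) • (square v).monomial Z α = 0 := by
  apply (square v).toMatrix.injective
  ext a b
  have := toMatrix_ncEval_inflatePoint v T Z p w a b
  rw [hp, map_zero, Matrix.zero_apply] at this
  rw [map_sum, Matrix.sum_apply, map_zero, Matrix.zero_apply, this]
  exact Finset.sum_congr rfl fun α _ => by
    rw [map_smul, Matrix.smul_apply, smul_eq_mul, mul_assoc]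

/-- Supplies the inclusions of relations needed for `IsScalarNCFunctionOn.eq_ncEval`: the relation
holds term by term, as every monomial with `T^α = 0` already vanishes. -/
theorem ncEval_inflatePoint_eq_zero {p : List (Fin d) →₀ ℂ}
    (hp : ∀ α, (α.map T).prod ≠ 0 → p α • (square v).monomial Z α = 0) :
    ncEval (inflatePoint v T Z).tuple p = 0 := by
  rw [ncEval_apply]
  refine Finset.sum_eq_zero fun α _ => ?_
  -- The constant term involves the identity, whose off-diagonal blocks must also vanish; each of
  -- its entries is zero or an entry of the original identity.
  rcases eq_or_ne α [] with rfl | hα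
  · apply (inflatePoint v T Z).prod.toMatrix.injective
    ext i j
    rw [map_smul, map_zero, Matrix.smul_apply, Matrix.zero_apply]
    change p [] • (square (matrixCoords v (inflateIndex ι W))).one i j = 0
    rw [one_eq_rankOne _ (square_presents _)]
    change p [] • (matrixCoords v _ (1 : Matrix W W 𝒜) i *
      star (matrixCoords v _ (1 : Matrix W W 𝒜) j)) = 0
    rw [matrixCoords_apply, matrixCoords_apply, Matrix.one_apply, Matrix.one_apply]
    split_ifs with h1 h2
    · have hW : (([] : List (Fin d)).map T).prod ≠ 0 := fun h0 => by
        have := congrFun (congrFun h0 (inflateIndex ι W i).1.1) (inflateIndex ι W i).1.1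
        simp at this
      have h3 := congrArg (square v).toMatrix (hp [] hW)
      have h4 := congrFun (congrFun h3 (inflateIndex ι W i).2) (inflateIndex ι W j).2
      change p [] • (square v).one _ _ = 0 at h4
      rwa [one_eq_rankOne _ (square_presents _)] at h4
    all_goals simp
  · change p α • (square (matrixCoords v (inflateIndex ι W))).monomial
      (fun i => inflate v (inflateIndex ι W) (T i) (Z i)) α = 0
    rw [monomial_inflate _ _ _ _ hα, ← inflate_smul_right]
    by_cases h0 : (α.map T).prod = 0
    · rw [h0]
      apply (square (matrixCoords v (inflateIndex ι W))).toMatrix.injective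
      rw [toMatrix_inflate]
      ext i j
      simp
    · rw [hp α h0]
      apply (square (matrixCoords v (inflateIndex ι W))).toMatrix.injective
      rw [toMatrix_inflate]
      ext i j
      simp

variable {v T Z}

theorem inflatePoint_mem (hT : ∀ i j k, 0 ≤ T i j k) {ρ : ℝ} (hρ : 0 ≤ ρ)
    (hTρ : ∀ i j, ∑ k, ‖T i j k‖ ≤ ρ) (hZ : ∀ i, ((square v).toMatrix (Z i)).PosDef)
    {C r : ℝ} (hr : 0 < r) (hρr : ρ * r < 1)
    (hZC : ∀ α a b, ‖(square v).toMatrix ((square v).monomial Z α) a b‖ ≤ C * r ^ α.length) :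
    inflatePoint v T Z ∈ schurSpectralContractions d :=
  isSchurSpectralContraction_inflate _ hT hρ hTρ hZ hr hρr hZC

theorem posSemidef_diagBlock {N : ℕ}
    {f : (x : SchurUniverse d) → Matrix (Fin N) (Fin N) x.prod.Alg}
    (hpos : SchurUniverse.IsPositivityPreservingOn f (schurSpectralContractions d))
    (hmem : inflatePoint v T Z ∈ schurSpectralContractions d)
    (hT : ∀ i j k, 0 ≤ T i j k) (hZ : ∀ i, ((square v).toMatrix (Z i)).PosDef) (w : W × W) :
    (diagBlock v T Z (f (inflatePoint v T Z)) w).PosSemidef :=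
  (hpos _ _ _ hmem (square_positivityPreserving _)
    fun i => posSemidef_inflate (hT i) (hZ i).posSemidef).submatrix _

end Sample

end GenSchurProduct

end

/-! ### Shifts and automata on short words -/

/-- The words of length at most `k`. -/
abbrev ShortWord (d k : ℕ) : Type := {α : List (Fin d) // α.length ≤ k}

instance (d k : ℕ) : Fintype (ShortWord d k) :=
  (List.finite_length_le (Fin d) k).fintype

namespace ShortWord

variable {d k : ℕ}

/-- The empty word. -/
def empty : ShortWord d k := ⟨[], Nat.zero_le k⟩

/-- The matrix of appending the letter `i`, where words longer than `k` are discarded. -/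
def shift (k : ℕ) (i : Fin d) : Matrix (ShortWord d k) (ShortWord d k) ℂ :=
  Matrix.of fun u w => if w.1 = u.1 ++ [i] then 1 else 0

theorem shift_apply (i : Fin d) (u w : ShortWord d k) :
    shift k i u w = if w.1 = u.1 ++ [i] then 1 else 0 := rfl

theorem list_prod_shift_apply (α : List (Fin d)) (u w : ShortWord d k) :
    (α.map (shift k)).prod u w = if w.1 = u.1 ++ α then 1 else 0 := by
  induction α generalizing u with
  | nil => simp [Matrix.one_apply, Subtype.ext_iff, eq_comm]
  | cons i α ih =>
    simp only [List.map_cons, List.prod_cons, Matrix.mul_apply, ih, shift_apply]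
    by_cases h : (u.1 ++ [i]).length ≤ k
    · rw [Finset.sum_eq_single ⟨u.1 ++ [i], h⟩]
      · simp
      · intro x _ hx
        rw [if_neg fun h' => hx (Subtype.ext h'), zero_mul]
      · simp
    · rw [if_neg]
      · refine Finset.sum_eq_zero fun x _ => ?_
        rw [if_neg fun h' : x.1 = u.1 ++ [i] => h (h' ▸ x.2), zero_mul]
      · intro h'
        have := congrArg List.length h'
        have := w.2
        simp at *
        omega

theorem list_prod_shift_ne_zero {α : List (Fin d)} (h : (α.map (shift k)).prod ≠ 0) :
    α.length ≤ k := by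
  by_contra hα
  refine h (Matrix.ext fun u w => ?_)
  rw [list_prod_shift_apply, if_neg, Matrix.zero_apply]
  intro h'
  have := congrArg List.length h'
  have := w.2
  simp at *
  omega

theorem shift_nonneg (i : Fin d) (u w : ShortWord d k) : 0 ≤ shift k i u w := by
  rw [shift_apply]
  split_ifs <;> simp

theorem sum_norm_shift_le (i : Fin d) (u : ShortWord d k) : ∑ w, ‖shift k i u w‖ ≤ 1 := by
  by_cases h : (u.1 ++ [i]).length ≤ k
  · rw [Finset.sum_eq_single ⟨u.1 ++ [i], h⟩]
    · simp [shift_apply]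
    · intro x _ hx
      rw [shift_apply, if_neg fun h' => hx (Subtype.ext h'), norm_zero]
    · simp
  · refine (Finset.sum_eq_zero fun x _ => ?_).trans_le zero_le_one
    rw [shift_apply, if_neg fun h' : x.1 = u.1 ++ [i] => h (h' ▸ x.2), norm_zero]

/-- The transition matrix of an automaton that records words of length at most `k` and sends
longer words to two further states, whose weights are `1` and `b`. -/
def automaton (k : ℕ) (b δ : ℝ) (i : Fin d) :
    Matrix (ShortWord d k ⊕ Bool) (ShortWord d k ⊕ Bool) ℂ :=
  Matrix.of fun
    | .inl u, .inl w => if w.1 = u.1 ++ [i] then (δ : ℂ) else 0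
    -- Starting from the empty word, this exit is taken by the letter number `k + 1`, whatever that
    -- letter is.
    | .inl u, .inr true => if u.1.length = k then (δ : ℂ) else 0
    | .inl _, .inr false => 0
    | .inr true, .inr true => 1
    | .inr true, .inr false => (δ : ℂ)
    | .inr false, .inr false => (b : ℂ)
    | .inr false, .inr true => 0
    | .inr _, .inl _ => 0

variable {b δ : ℝ}

theorem automaton_nonneg (hb : 0 ≤ b) (hδ : 0 ≤ δ) (i : Fin d) (s t : ShortWord d k ⊕ Bool) :
    0 ≤ automaton k b δ i s t := by
  rcases s with u | _ | _ <;> rcases t with w | _ | _ <;>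
    simp only [automaton, Matrix.of_apply] <;> try split_ifs
  all_goals simp [hb, hδ]

/-- The rows of words sum to at most `2 * δ`, those of the two loops to `1 + δ` and `b`. -/
theorem sum_norm_automaton_le (hb : 1 ≤ b) (hδ : 0 ≤ δ) (hδ1 : δ ≤ 1) (i : Fin d)
    (s : ShortWord d k ⊕ Bool) : ∑ t, ‖automaton k b δ i s t‖ ≤ b + δ := by
  rw [Fintype.sum_sum_type, Fintype.sum_bool]
  rcases s with u | _ | _
  · have h1 : ∑ w, ‖automaton k b δ i (.inl u) (.inl w)‖ ≤ δ := by
      have : ∀ w, ‖automaton k b δ i (.inl u) (.inl w)‖ = δ * ‖shift k i u w‖ := fun w => by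
        simp only [automaton, Matrix.of_apply, shift_apply]
        split_ifs <;> simp [abs_of_nonneg hδ]
      simp only [this, ← Finset.mul_sum]
      exact mul_le_of_le_one_right hδ (sum_norm_shift_le i u)
    have h2 : ‖automaton k b δ i (.inl u) (.inr true)‖ ≤ δ := by
      simp only [automaton, Matrix.of_apply]
      split_ifs <;> simp [abs_of_nonneg hδ, hδ]
    have h3 : ‖automaton k b δ i (.inl u) (.inr false)‖ = 0 := by simp [automaton]
    linarith
  · simp [automaton, abs_of_nonneg (zero_le_one.trans hb), hδ]
  · simp [automaton, abs_of_nonneg hδ, hb]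

theorem list_prod_automaton_false_true (α : List (Fin d)) :
    (α.map (automaton k b δ)).prod (.inr false) (.inr true) = 0 := by
  induction α with
  | nil => simp
  | cons i α ih => simp [Matrix.mul_apply, ih, automaton]

/-- The loop weights `1` and `b` make these diagonal entries carry `Z` and `b Z`, so the polynomial
of `f` at the automaton point also computes `f` at both of those. -/
theorem list_prod_automaton_true_true (α : List (Fin d)) :
    (α.map (automaton k b δ)).prod (.inr true) (.inr true) = 1 := by
  induction α with
  | nil => simp
  | cons i α ih => simp [Matrix.mul_apply, ih, automaton, list_prod_automaton_false_true]

theorem list_prod_automaton_false_false (α : List (Fin d)) :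
    (α.map (automaton k b δ)).prod (.inr false) (.inr false) = (b : ℂ) ^ α.length := by
  induction α with
  | nil => simp
  | cons i α ih => simp [Matrix.mul_apply, ih, automaton, pow_succ']

/-- Sum over paths. Reaching the state `true` takes `k + 1` steps of weight `δ`; passing on to
`false` takes one more, at any later letter, and the `j` letters that then remain contribute `b ^
j`. -/
theorem list_prod_automaton_empty (α : List (Fin d)) :
    (∀ w : ShortWord d k, (α.map (automaton k b δ)).prod (.inl empty) (.inl w) =
      if w.1 = α then (δ : ℂ) ^ α.length else 0) ∧
    ((α.map (automaton k b δ)).prod (.inl empty) (.inr true) =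
      if α.length ≤ k then 0 else (δ : ℂ) ^ (k + 1)) ∧
    ((α.map (automaton k b δ)).prod (.inl empty) (.inr false) =
      if α.length ≤ k then 0 else
        (δ : ℂ) ^ (k + 2) * ∑ j ∈ Finset.range (α.length - (k + 1)), (b : ℂ) ^ j) := by
  induction α using List.reverseRecOn with
  | nil => simp [Matrix.one_apply, Subtype.ext_iff, empty, eq_comm]
  | append_singleton α i ih =>
    obtain ⟨h1, h2, h3⟩ := ih
    have key : ∀ t, ((α ++ [i]).map (automaton k b δ)).prod (.inl empty) t =
        (if h : α.length ≤ k then (δ : ℂ) ^ α.length * automaton k b δ i (.inl ⟨α, h⟩) t else 0) +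
        ((if α.length ≤ k then 0 else (δ : ℂ) ^ (k + 1)) * automaton k b δ i (.inr true) t +
        (if α.length ≤ k then 0 else
        (δ : ℂ) ^ (k + 2) * ∑ j ∈ Finset.range (α.length - (k + 1)), (b : ℂ) ^ j) *
          automaton k b δ i (.inr false) t) := by
      intro t
      rw [List.map_append, List.prod_append, List.map_singleton, List.prod_singleton,
        Matrix.mul_apply, Fintype.sum_sum_type, Fintype.sum_bool, h2, h3]
      congr 1
      simp only [h1]
      split_ifs with h
      · rw [Finset.sum_eq_single ⟨α, h⟩]
        · simp
        · intro w _ hw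
          rw [if_neg fun h' => hw (Subtype.ext h'), zero_mul]
        · simp
      · refine Finset.sum_eq_zero fun w _ => ?_
        rw [if_neg fun h' : w.1 = α => h (h' ▸ w.2), zero_mul]
    refine ⟨fun w => ?_, ?_, ?_⟩
    · rw [key]
      by_cases h : α.length ≤ k
      · simp [h, automaton, pow_succ]
      · have : w.1 ≠ α ++ [i] := fun h' => by
          have h4 := congrArg List.length h'
          have := w.2
          simp at h4
          omega
        simp [h, automaton, this]
    · rw [key]
      rcases lt_trichotomy α.length k with h | h | h
      · simp [h.le, automaton, h.ne, Nat.succ_le_of_lt h]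
      · simp [h, automaton, pow_succ]
      · simp [not_le.2 h, automaton, show ¬ α.length + 1 ≤ k by omega]
    · rw [key]
      rcases lt_trichotomy α.length k with h | h | h
      · simp [h.le, automaton, Nat.succ_le_of_lt h]
      · simp [h, automaton]
      · have h5 : α.length - k = (α.length - (k + 1)) + 1 := by omega
        simp [not_le.2 h, automaton, show ¬ α.length + 1 ≤ k by omega, h5,
          Finset.sum_range_succ', pow_succ]
        rw [← Finset.sum_mul]
        ring

end ShortWord

/-! ### Convergence of series of positive semidefinite matrices -/

/-- Reduces convergence of all entries to that of the diagonal; a crude form of the Cauchy–Schwarz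
bound, proved on rank one summands. -/
theorem Matrix.PosSemidef.norm_apply_le {I : Type*} [Finite I] {M : Matrix I I ℂ}
    (hM : M.PosSemidef) (i j : I) : ‖M i j‖ ≤ (M i i).re + (M j j).re := by
  obtain ⟨m, x, rfl⟩ := Matrix.posSemidef_iff_eq_sum_vecMulVec.mp hM
  have h : ∀ i, ((∑ l, Matrix.vecMulVec (x l) (star (x l))) i i).re = ∑ l, ‖x l i‖ ^ 2 := by
    intro i
    rw [Matrix.sum_apply, Complex.re_sum]
    refine Finset.sum_congr rfl fun l _ => ?_
    rw [Matrix.vecMulVec_apply, Pi.star_apply, Complex.star_def, Complex.mul_conj,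
      Complex.ofReal_re, Complex.normSq_eq_norm_sq]
  rw [h, h, ← Finset.sum_add_distrib, Matrix.sum_apply]
  refine norm_sum_le_of_le _ fun l _ => ?_
  rw [Matrix.vecMulVec_apply, Pi.star_apply, norm_mul, norm_star]
  nlinarith [sq_nonneg (‖x l i‖ - ‖x l j‖), sq_nonneg (‖x l i‖), sq_nonneg (‖x l j‖)]

theorem Matrix.PosSemidef.re_apply_nonneg {I : Type*} {M : Matrix I I ℂ}
    (hM : M.PosSemidef) (i : I) : 0 ≤ (M i i).re :=
  (Complex.nonneg_iff.1 hM.diag_nonneg).1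

/-- The finite set of words of length at most `k`. -/
def shortWords (d k : ℕ) : Finset (List (Fin d)) :=
  (List.finite_length_le (Fin d) k).toFinset

theorem mem_shortWords {d k : ℕ} {α : List (Fin d)} : α ∈ shortWords d k ↔ α.length ≤ k := by
  simp [shortWords]

theorem tendsto_shortWords (d : ℕ) : Filter.Tendsto (shortWords d) Filter.atTop Filter.atTop := by
  refine Filter.tendsto_atTop_finset_of_monotone (fun k l hkl α hα => ?_) fun α =>
    ⟨α.length, mem_shortWords.2 le_rfl⟩
  exact mem_shortWords.2 ((mem_shortWords.1 hα).trans hkl)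

/-- A series of positive semidefinite matrices indexed by words converges entrywise when its
remainders are positive semidefinite and dominated by a geometric sequence. -/
theorem hasSum_apply_of_posSemidef_remainder {I : Type*} [Finite I] {d : ℕ}
    {t : List (Fin d) → Matrix I I ℂ} (ht : ∀ α, (t α).PosSemidef) {G H : Matrix I I ℂ} {b : ℝ}
    (hb : 1 < b) (hG : ∀ k, (G - ∑ α ∈ shortWords d k, t α).PosSemidef)
    (hH : ∀ k, (((b : ℂ) ^ (k + 1))⁻¹ • H - (G - ∑ α ∈ shortWords d k, t α)).PosSemidef)
    (i j : I) : HasSum (fun α => t α i j) (G i j) := by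
  -- Positive remainders bound the diagonal partial sums by `G i i`; this gives absolute
  -- convergence, and only the value of the sum then needs the geometric bound.
  have hdiag : ∀ i, Summable fun α => (t α i i).re := fun i => by
    refine summable_of_sum_le (c := (G i i).re) (fun α => (ht α).re_apply_nonneg i) fun u => ?_
    obtain ⟨k, hk⟩ := ((tendsto_shortWords d).eventually_ge_atTop u).exists
    refine (Finset.sum_le_sum_of_subset_of_nonneg hk
      fun α _ _ => (ht α).re_apply_nonneg i).trans ?_
    have := (hG k).re_apply_nonneg i
    rw [Matrix.sub_apply, Matrix.sum_apply, Complex.sub_re, Complex.re_sum] at this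
    linarith
  have hsum : Summable fun α => t α i j :=
    Summable.of_norm_bounded ((hdiag i).add (hdiag j)) fun α => (ht α).norm_apply_le i j
  have hlim : Filter.Tendsto (fun k => (∑ α ∈ shortWords d k, t α i j)) Filter.atTop
      (nhds (G i j)) := by
    rw [tendsto_iff_norm_sub_tendsto_zero]
    have hb0 : 0 < b := zero_lt_one.trans hb
    have hg : Filter.Tendsto (fun k : ℕ => (b⁻¹ ^ (k + 1)) * ((H i i).re + (H j j).re))
        Filter.atTop (nhds (0 * ((H i i).re + (H j j).re))) :=
      ((tendsto_pow_atTop_nhds_zero_of_lt_one (inv_nonneg.2 hb0.le)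
        (inv_lt_one_of_one_lt₀ hb)).comp (Filter.tendsto_add_atTop_nat 1)).mul_const _
    rw [zero_mul] at hg
    refine squeeze_zero (fun k => norm_nonneg _) (fun k => ?_) hg
    have hle : ∀ i, ((G - ∑ α ∈ shortWords d k, t α) i i).re ≤ b⁻¹ ^ (k + 1) * (H i i).re := by
      intro i
      have := (hH k).re_apply_nonneg i
      rw [Matrix.sub_apply, Complex.sub_re, Matrix.smul_apply, smul_eq_mul, ← inv_pow,
        ← Complex.ofReal_inv, ← Complex.ofReal_pow, Complex.re_ofReal_mul] at this
      linarith
    rw [norm_sub_rev, ← Matrix.sum_apply, ← Matrix.sub_apply]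
    refine ((hG k).norm_apply_le i j).trans ?_
    rw [mul_add]
    exact add_le_add (hle i) (hle j)
  have := tendsto_nhds_unique (hsum.hasSum.comp (tendsto_shortWords d)) hlim
  exact this ▸ hsum.hasSum

namespace SchurUniverse

open GenSchurProduct ShortWord

/-! ### Coefficients from shifts of the scalar tuple `1/2` -/

section Coefficients

variable {d N : ℕ}

/-- The complex numbers with the standard coordinate. -/
def complexCoords : ℂ ≃ₗ[ℂ] (Unit → ℂ) := (LinearEquiv.funUnique Unit ℂ ℂ).symm

theorem square_complexCoords_one : (square complexCoords).one = 1 := by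
  rw [one_eq_rankOne _ (square_presents _)]
  ext
  change (1 : ℂ) * star 1 = _
  simp

/-- The constant tuple `1/2`. -/
def halfTuple (_ : Fin d) : (square complexCoords).Alg := (2⁻¹ : ℂ) • 1

theorem toMatrix_monomial_halfTuple (α : List (Fin d)) :
    (square complexCoords).toMatrix ((square complexCoords).monomial halfTuple α) =
      ((2⁻¹ : ℂ) ^ α.length) • (1 : Matrix Unit Unit ℂ) := by
  have : (square complexCoords).monomial halfTuple α = ((2⁻¹ : ℂ) ^ α.length) • 1 := by
    rw [monomial, show (halfTuple : Fin d → _) = fun _ => (2⁻¹ : ℂ) • 1 from rfl,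
      List.map_const', List.prod_replicate, smul_pow, one_pow]
  rw [this, map_smul]
  congr 1
  exact square_complexCoords_one

theorem posDef_halfTuple (i : Fin d) :
    ((square complexCoords).toMatrix (halfTuple i)).PosDef := by
  have := toMatrix_monomial_halfTuple [i]
  rw [monomial, List.map_singleton, List.prod_singleton] at this
  rw [this]
  refine Matrix.PosDef.one.smul ?_
  simp

/-- The tuple of shifts on words of length at most `k`. -/
abbrev shiftPoint (d k : ℕ) : SchurUniverse d := inflatePoint complexCoords (shift k) halfTuple

theorem shiftPoint_mem (k : ℕ) : shiftPoint d k ∈ schurSpectralContractions d := by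
  refine inflatePoint_mem shift_nonneg zero_le_one sum_norm_shift_le posDef_halfTuple
    (C := 1) (r := 2⁻¹) (by norm_num) (by norm_num) fun α a b => ?_
  rw [toMatrix_monomial_halfTuple]
  simp

/-- The row of the empty word sends each word `α` to its own column, so the shift point has no
relations among words of length at most `k`. -/
theorem coeff_eq_zero_of_ncEval_shiftPoint {k : ℕ} {p : List (Fin d) →₀ ℂ}
    (hp : ncEval (shiftPoint d k).tuple p = 0) {α : List (Fin d)} (hα : α.length ≤ k) :
    p α = 0 := by
  have h := sum_eq_zero_of_ncEval_eq_zero _ _ _ hp (empty, ⟨α, hα⟩)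
  simp only [list_prod_shift_apply, empty, List.nil_append] at h
  by_contra h0
  rw [Finset.sum_eq_single α (fun β _ hβ => by simp [hβ.symm])
    (fun h' => absurd (Finsupp.notMem_support_iff.1 h') h0), if_pos rfl, mul_one] at h
  have h1 := congrArg (square complexCoords).toMatrix h
  rw [map_smul, toMatrix_monomial_halfTuple] at h1
  have h2 := congrFun (congrFun h1 ()) ()
  simp at h2
  exact h0 h2

/-- The matrix coefficients of a noncommutative function. -/
def coeffMatrix (f : (x : SchurUniverse d) → Matrix (Fin N) (Fin N) x.prod.Alg)
    (α : List (Fin d)) : Matrix (Fin N) (Fin N) ℂ :=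
  -- The factor undoes the monomial `(1/2)^|α|` of the scalar tuple, which is halved to be a
  -- contraction.
  (2 : ℂ) ^ α.length • (diagBlock complexCoords (shift α.length) halfTuple
    (f (shiftPoint d α.length)) (empty, ⟨α, le_rfl⟩)).submatrix (fun s => (s, ())) (fun s => (s, ()))

variable {f : (x : SchurUniverse d) → Matrix (Fin N) (Fin N) x.prod.Alg}

theorem posSemidef_coeffMatrix
    (hpos : IsPositivityPreservingOn f (schurSpectralContractions d)) (α : List (Fin d)) :
    (coeffMatrix f α).PosSemidef :=
  ((posSemidef_diagBlock hpos (shiftPoint_mem _) shift_nonneg posDef_halfTuple _).submatrix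
    _).smul (by positivity)

/-- Coefficients do not depend on the truncation: relations of the shift point of level `k` hold at
level `|α| ≤ k`, so `p` may be evaluated there. -/
theorem eq_coeffMatrix (hf : IsNCFunctionOn f (schurSpectralContractions d)) {k : ℕ} {s t : Fin N}
    {p : List (Fin d) →₀ ℂ} (hp : f (shiftPoint d k) s t = ncEval (shiftPoint d k).tuple p)
    {α : List (Fin d)} (hα : α.length ≤ k) : p α = coeffMatrix f α s t := by
  have h := (hf s t).eq_ncEval (shiftPoint_mem k) (shiftPoint_mem α.length) (fun q hq =>
    ncEval_inflatePoint_eq_zero _ _ _ fun β hβ => by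
      rw [coeff_eq_zero_of_ncEval_shiftPoint hq ((list_prod_shift_ne_zero hβ).trans hα),
        zero_smul]) hp
  rw [coeffMatrix, Matrix.smul_apply, Matrix.submatrix_apply, diagBlock_apply _ _ _ h]
  simp only [list_prod_shift_apply, empty, List.nil_append, toMatrix_monomial_halfTuple]
  rw [Finset.sum_eq_single α (fun β _ hβ => by simp [hβ.symm])
    (fun h' => by simp [Finsupp.notMem_support_iff.1 h'])]
  simp only [if_true, Matrix.smul_apply, Matrix.one_apply_eq, smul_eq_mul, mul_one, one_mul,
    inv_pow]
  field_simp

end Coefficients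

end SchurUniverse

theorem Matrix.PosSemidef.of_ofReal_smul {I : Type*} {M : Matrix I I ℂ} {c : ℝ} (hc : 0 < c)
    (h : ((c : ℂ) • M).PosSemidef) : M.PosSemidef := by
  have h0 : (0 : ℂ) ≤ (c⁻¹ : ℝ) := by exact_mod_cast (inv_pos.2 hc).le
  have := h.smul h0
  rwa [smul_smul, ← Complex.ofReal_mul, inv_mul_cancel₀ hc.ne', Complex.ofReal_one,
    one_smul] at this

namespace SchurUniverse

open GenSchurProduct ShortWord

theorem sum_support_sub_sum_shortWords {d : ℕ} (p : List (Fin d) →₀ ℂ) (z : List (Fin d) → ℂ)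
    (k : ℕ) : ∑ α ∈ p.support, p α * z α - ∑ α ∈ shortWords d k, p α * z α =
      ∑ α ∈ p.support, if α.length ≤ k then 0 else p α * z α := by
  have h : ∑ α ∈ shortWords d k, p α * z α =
      ∑ α ∈ p.support, if α.length ≤ k then p α * z α else 0 := by
    rw [← Finset.sum_filter]
    symm
    refine Finset.sum_subset (fun α hα => mem_shortWords.2 (Finset.mem_filter.1 hα).2)
      fun α hα hα' => ?_
    have : p α = 0 := by
      by_contra h0
      exact hα' (Finset.mem_filter.2 ⟨Finsupp.mem_support_iff.2 h0, mem_shortWords.1 hα⟩)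
    rw [this, zero_mul]
  rw [h, ← Finset.sum_sub_distrib]
  refine Finset.sum_congr rfl fun α _ => ?_
  split_ifs <;> simp

/-! ### Rescaled points and bounds for the remainders -/

variable {d N : ℕ}

/-- The constant `1` by `1` matrix `b` for each letter. -/
def scalarMatrix (b : ℝ) (_ : Fin d) : Matrix Unit Unit ℂ := Matrix.of fun _ _ => (b : ℂ)

theorem list_prod_scalarMatrix (b : ℝ) (α : List (Fin d)) :
    (α.map (scalarMatrix b)).prod () () = (b : ℂ) ^ α.length := by
  induction α with
  | nil => simp
  | cons i α ih => simp [Matrix.mul_apply, ih, scalarMatrix, pow_succ']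

variable {ι : Type} [Fintype ι] [DecidableEq ι] {𝒜 : Type} [Ring 𝒜] [Algebra ℂ 𝒜]
  (v : 𝒜 ≃ₗ[ℂ] (ι → ℂ)) (Z : Fin d → (square v).Alg)

/-- The rescaled tuple `b Z`. -/
abbrev scalarPoint (b : ℝ) : SchurUniverse d := inflatePoint v (scalarMatrix b) Z

theorem ncEval_scalarPoint_eq_zero {b : ℝ} {p : List (Fin d) →₀ ℂ}
    (hp : ∑ α ∈ p.support, (p α * (b : ℂ) ^ α.length) • (square v).monomial Z α = 0) :
    ncEval (scalarPoint v Z b).tuple p = 0 := by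
  apply (scalarPoint v Z b).prod.toMatrix.injective
  ext i j
  obtain ⟨⟨w, a⟩, rfl⟩ := (inflateIndex ι Unit).symm.surjective i
  obtain ⟨⟨w', c⟩, rfl⟩ := (inflateIndex ι Unit).symm.surjective j
  have h := congrFun (congrFun (congrArg (square v).toMatrix hp) a) c
  rw [map_sum, Matrix.sum_apply, map_zero, Matrix.zero_apply] at h
  rw [Subsingleton.elim w' w, toMatrix_ncEval_inflatePoint, map_zero, Matrix.zero_apply, ← h]
  refine Finset.sum_congr rfl fun α _ => ?_
  rw [map_smul, Matrix.smul_apply, smul_eq_mul, mul_assoc, ← list_prod_scalarMatrix]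

/-- The value of `f` at the rescaled tuple `b Z`. -/
def scalarValue (f : (x : SchurUniverse d) → Matrix (Fin N) (Fin N) x.prod.Alg) (b : ℝ) :
    Matrix (Fin N × ι) (Fin N × ι) ℂ :=
  diagBlock v (scalarMatrix b) Z (f (scalarPoint v Z b)) ((), ())

variable {v Z} {f : (x : SchurUniverse d) → Matrix (Fin N) (Fin N) x.prod.Alg}

theorem scalarPoint_mem {b : ℝ} (hb : 0 ≤ b) (hZ : ∀ i, ((square v).toMatrix (Z i)).PosDef)
    {C r : ℝ} (hr : 0 < r) (hbr : b * r < 1)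
    (hZC : ∀ α a b, ‖(square v).toMatrix ((square v).monomial Z α) a b‖ ≤ C * r ^ α.length) :
    scalarPoint v Z b ∈ schurSpectralContractions d :=
  inflatePoint_mem (fun _ _ _ => by simpa [scalarMatrix] using hb) hb
    (fun _ _ => by simp [scalarMatrix, abs_of_nonneg hb]) hZ hr hbr hZC

theorem posSemidef_monomial_of_posDef (hZ : ∀ i, ((square v).toMatrix (Z i)).PosDef)
    (α : List (Fin d)) : ((square v).toMatrix ((square v).monomial Z α)).PosSemidef :=
  posSemidef_monomial (square_positivityPreserving v) (posSemidef_square_one v)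
    (fun i => (hZ i).posSemidef) α

section Remainders

variable (hf : IsNCFunctionOn f (schurSpectralContractions d))
  (hpos : IsPositivityPreservingOn f (schurSpectralContractions d))
  (hZ : ∀ i, ((square v).toMatrix (Z i)).PosDef) {C r b δ : ℝ} (hr : 0 < r)
  (hb : 1 < b) (hδ : 0 < δ) (hδ1 : δ ≤ 1) (hbδ : (b + δ) * r < 1)
  (hZC : ∀ α a b, ‖(square v).toMatrix ((square v).monomial Z α) a b‖ ≤ C * r ^ α.length)

include hf hZ hr hb hδ hδ1 hbδ hZC

/-- The polynomials of a noncommutative function at the automaton tuple built from `Z` agree with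
its coefficients on short words and compute its values at `Z` and at `b Z`. -/
theorem exists_automaton_polynomial (k : ℕ) (s t : Fin N) :
    ∃ p : List (Fin d) →₀ ℂ,
      f (inflatePoint v (automaton k b δ) Z) s t =
        ncEval (inflatePoint v (automaton k b δ) Z).tuple p ∧
      (∀ α, α.length ≤ k → ∀ a c, p α * (square v).toMatrix ((square v).monomial Z α) a c =
        coeffMatrix f α s t * (square v).toMatrix ((square v).monomial Z α) a c) ∧
      (∀ a c, scalarValue v Z f 1 (s, a) (t, c) = ∑ α ∈ p.support,
        p α * (square v).toMatrix ((square v).monomial Z α) a c) ∧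
      (∀ a c, scalarValue v Z f b (s, a) (t, c) = ∑ α ∈ p.support, p α *
        ((b : ℂ) ^ α.length * (square v).toMatrix ((square v).monomial Z α) a c)) := by
  have hr1 : r < 1 := by nlinarith
  have hX : inflatePoint v (automaton k b δ) Z ∈ schurSpectralContractions d :=
    inflatePoint_mem (automaton_nonneg (by linarith) hδ.le) (by linarith)
      (sum_norm_automaton_le hb.le hδ.le hδ1) hZ hr hbδ hZC
  have hY : inflatePoint v (shift k) Z ∈ schurSpectralContractions d :=
    inflatePoint_mem shift_nonneg zero_le_one sum_norm_shift_le hZ hr (by linarith) hZC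
  obtain ⟨p, hp⟩ := (hf s t).exists_ncEval hX
  obtain ⟨q, hq⟩ := (hf s t).exists_ncEval (shiftPoint_mem (d := d) k)
  refine ⟨p, hp, fun α hα a c => ?_, fun a c => ?_, fun a c => ?_⟩
  -- The shifts of `Z` satisfy the relations of the automaton point and those of the scalar shift
  -- point. Comparing the two polynomials there determines only `p α Z^α`, since `Z^α` is not known
  -- to be nonzero.
  · have h1 := (hf s t).eq_ncEval hX hY (fun p hp => ncEval_inflatePoint_eq_zero _ _ _
      fun β hβ => by
        have hβk := list_prod_shift_ne_zero hβ
        have h := sum_eq_zero_of_ncEval_eq_zero _ _ _ hp (.inl empty, .inl ⟨β, hβk⟩)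
        simp only [(list_prod_automaton_empty _).1] at h
        by_cases h0 : p β = 0
        · rw [h0, zero_smul]
        rw [Finset.sum_eq_single β (fun γ _ hγ => by simp [hγ.symm])
          (fun h' => absurd (Finsupp.notMem_support_iff.1 h') h0), if_pos rfl, mul_comm,
          mul_smul] at h
        exact (smul_eq_zero.1 h).resolve_left (pow_ne_zero _ (by exact_mod_cast hδ.ne'))) hp
    have h2 := (hf s t).eq_ncEval (shiftPoint_mem k) hY (fun p hp =>
      ncEval_inflatePoint_eq_zero _ _ _ fun β hβ => by
        rw [coeff_eq_zero_of_ncEval_shiftPoint hp (list_prod_shift_ne_zero hβ), zero_smul]) hq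
    have key : ∀ p : List (Fin d) →₀ ℂ, f (inflatePoint v (shift k) Z) s t =
        ncEval (inflatePoint v (shift k) Z).tuple p →
        diagBlock v (shift k) Z (f (inflatePoint v (shift k) Z)) (empty, ⟨α, hα⟩) (s, a) (t, c) =
          p α * (square v).toMatrix ((square v).monomial Z α) a c := fun p hp => by
      rw [diagBlock_apply _ _ _ hp]
      simp only [list_prod_shift_apply, empty, List.nil_append]
      rw [Finset.sum_eq_single α (fun β _ hβ => by simp [hβ.symm])
        (fun h' => by simp [Finsupp.notMem_support_iff.1 h'])]
      simp
    rw [← key p h1, key q h2, eq_coeffMatrix hf hq hα]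
  · have h := (hf s t).eq_ncEval hX (scalarPoint_mem (b := 1) zero_le_one hZ hr (by linarith) hZC)
      (fun p hp => ncEval_scalarPoint_eq_zero _ _ (by
        have h := sum_eq_zero_of_ncEval_eq_zero _ _ _ hp (.inr true, .inr true)
        simpa only [list_prod_automaton_true_true, mul_one, Complex.ofReal_one, one_pow]
          using h)) hp
    rw [scalarValue, diagBlock_apply _ _ _ h]
    simp [list_prod_scalarMatrix]
  · have h := (hf s t).eq_ncEval hX (scalarPoint_mem (b := b) (by linarith) hZ hr
      (by nlinarith) hZC)
      (fun p hp => ncEval_scalarPoint_eq_zero _ _ (by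
        have h := sum_eq_zero_of_ncEval_eq_zero _ _ _ hp (.inr false, .inr false)
        simpa only [list_prod_automaton_false_false] using h)) hp
    rw [scalarValue, diagBlock_apply _ _ _ h]
    simp [list_prod_scalarMatrix]

include hpos

/-- Two entries of the automaton, from the empty word to each loop state, are positive blocks of
`f`. One is a multiple of the remainder; the other bounds the remainder by that of `f(bZ)`, scaled
by `b^{-(k+1)}`. -/
theorem posSemidef_remainders (k : ℕ) :
    (scalarValue v Z f 1 - ∑ α ∈ shortWords d k,
      coeffMatrix f α ⊗ₖ (square v).toMatrix ((square v).monomial Z α)).PosSemidef ∧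
    (((b : ℂ) ^ (k + 1))⁻¹ • scalarValue v Z f b - (scalarValue v Z f 1 - ∑ α ∈ shortWords d k,
      coeffMatrix f α ⊗ₖ (square v).toMatrix ((square v).monomial Z α))).PosSemidef := by
  have hX : inflatePoint v (automaton k b δ) Z ∈ schurSpectralContractions d :=
    inflatePoint_mem (automaton_nonneg (by linarith) hδ.le) (by linarith)
      (sum_norm_automaton_le hb.le hδ.le hδ1) hZ hr hbδ hZC
  have hpsd := posSemidef_diagBlock hpos hX (automaton_nonneg (by linarith) hδ.le) hZ
  choose p hp hcoef h1 hb1 using exists_automaton_polynomial hf hZ hr hb hδ hδ1 hbδ hZC k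
  have hbC : (b : ℂ) ≠ 0 := by exact_mod_cast (zero_lt_one.trans hb).ne'
  have hb1C : (b : ℂ) - 1 ≠ 0 := by
    rw [sub_ne_zero]
    exact_mod_cast hb.ne'
  set t : List (Fin d) → Matrix (Fin N × ι) (Fin N × ι) ℂ := fun α =>
    coeffMatrix f α ⊗ₖ (square v).toMatrix ((square v).monomial Z α) with ht
  have ht0 : ∀ α, (t α).PosSemidef := fun α =>
    (posSemidef_coeffMatrix hpos α).kronecker (posSemidef_monomial_of_posDef hZ α)
  have hA : diagBlock v (automaton k b δ) Z (f (inflatePoint v (automaton k b δ) Z))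
      (.inl empty, .inr true) =
      (δ : ℂ) ^ (k + 1) • (scalarValue v Z f 1 - ∑ α ∈ shortWords d k, t α) := by
    ext ⟨s, a⟩ ⟨u, c⟩
    rw [diagBlock_apply _ _ _ (hp s u), Matrix.smul_apply, Matrix.sub_apply, Matrix.sum_apply, h1,
      show ∑ α ∈ shortWords d k, t α (s, a) (u, c) = ∑ α ∈ shortWords d k,
        p s u α * (square v).toMatrix ((square v).monomial Z α) a c from
        Finset.sum_congr rfl fun α hα => (hcoef s u α (mem_shortWords.1 hα) a c).symm,
      sum_support_sub_sum_shortWords, smul_eq_mul, Finset.mul_sum]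
    refine Finset.sum_congr rfl fun α _ => ?_
    rw [(list_prod_automaton_empty α).2.1]
    split_ifs
    · simp
    · ring
  -- The geometric sum is `(b^{|α|-(k+1)} - 1) / (b - 1)`: its power of `b` gives the remainder at
  -- `b Z`, and the `-1` the remainder at `Z`.
  have hB : diagBlock v (automaton k b δ) Z (f (inflatePoint v (automaton k b δ) Z))
      (.inl empty, .inr false) =
      ((δ : ℂ) ^ (k + 2) / (b - 1)) • (((b : ℂ) ^ (k + 1))⁻¹ • (scalarValue v Z f b -
        ∑ α ∈ shortWords d k, (b : ℂ) ^ α.length • t α) -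
        (scalarValue v Z f 1 - ∑ α ∈ shortWords d k, t α)) := by
    ext ⟨s, a⟩ ⟨u, c⟩
    rw [diagBlock_apply _ _ _ (hp s u), Matrix.smul_apply, Matrix.sub_apply, Matrix.smul_apply,
      Matrix.sub_apply, Matrix.sub_apply, Matrix.sum_apply, Matrix.sum_apply, h1, hb1,
      show ∑ α ∈ shortWords d k, t α (s, a) (u, c) = ∑ α ∈ shortWords d k,
        p s u α * (square v).toMatrix ((square v).monomial Z α) a c from
        Finset.sum_congr rfl fun α hα => (hcoef s u α (mem_shortWords.1 hα) a c).symm,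
      show ∑ α ∈ shortWords d k, ((b : ℂ) ^ α.length • t α) (s, a) (u, c) =
        ∑ α ∈ shortWords d k, p s u α *
          ((b : ℂ) ^ α.length * (square v).toMatrix ((square v).monomial Z α) a c) from
        Finset.sum_congr rfl fun α hα => by
          rw [mul_left_comm, hcoef s u α (mem_shortWords.1 hα) a c]
          rfl,
      sum_support_sub_sum_shortWords, sum_support_sub_sum_shortWords, smul_eq_mul, smul_eq_mul,
      Finset.mul_sum, ← Finset.sum_sub_distrib, Finset.mul_sum]
    refine Finset.sum_congr rfl fun α _ => ?_
    rw [(list_prod_automaton_empty α).2.2]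
    split_ifs with h
    · simp
    · rw [geom_sum_eq (sub_ne_zero.1 hb1C)]
      obtain ⟨n, hn⟩ := Nat.exists_eq_add_of_lt (not_le.1 h)
      rw [hn, show k + n + 1 - (k + 1) = n by omega, show k + n + 1 = (k + 1) + n by ring,
        pow_add (b : ℂ) (k + 1) n]
      field_simp
  have hRA : (scalarValue v Z f 1 - ∑ α ∈ shortWords d k, t α).PosSemidef := by
    refine Matrix.PosSemidef.of_ofReal_smul (pow_pos hδ (k + 1)) ?_
    rw [Complex.ofReal_pow, ← hA]
    exact hpsd _
  refine ⟨hRA, ?_⟩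
  have hRB : (((b : ℂ) ^ (k + 1))⁻¹ • (scalarValue v Z f b -
        ∑ α ∈ shortWords d k, (b : ℂ) ^ α.length • t α) -
        (scalarValue v Z f 1 - ∑ α ∈ shortWords d k, t α)).PosSemidef := by
    refine Matrix.PosSemidef.of_ofReal_smul (div_pos (pow_pos hδ (k + 2)) (sub_pos.2 hb)) ?_
    push_cast
    rw [← hB]
    exact hpsd _
  have hbC0 : (0 : ℂ) ≤ b := by exact_mod_cast (zero_lt_one.trans hb).le
  -- Adding back the positive short terms at `b Z` leaves all of `f(bZ)` as the upper bound.
  have hS : (((b : ℂ) ^ (k + 1))⁻¹ •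
      ∑ α ∈ shortWords d k, (b : ℂ) ^ α.length • t α).PosSemidef :=
    (Matrix.posSemidef_sum _ fun α _ => (ht0 α).smul (pow_nonneg hbC0 _)).smul
      (inv_nonneg_of_nonneg (pow_nonneg hbC0 _))
  convert hRB.add hS using 1
  rw [smul_sub]
  abel

end Remainders

/-! ### The expansion at an arbitrary contraction -/

/-- The series converges at the positive definite `Z` of which `x` is an off-diagonal block;
extracting that block is a homomorphism, so it carries monomials and values of `f` to those of `x`.
-/
theorem hasSum_coeffMatrix {f : (x : SchurUniverse d) → Matrix (Fin N) (Fin N) x.prod.Alg}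
    (hf : IsNCFunctionOn f (schurSpectralContractions d))
    (hpos : IsPositivityPreservingOn f (schurSpectralContractions d)) {x : SchurUniverse d}
    (hx : x ∈ schurSpectralContractions d) :
    HasSum (fun α => coeffMatrix f α ⊗ₖ x.prod.toMatrix (x.prod.monomial x.tuple α))
      (x.prod.blockMatrix (f x)) := by
  obtain ⟨𝒜, _, _, v, Z, φ, C, r, hφ, hφZ, hZ, hr, hr1, hZC⟩ :=
    IsSchurSpectralContraction.exists_square hx
  obtain ⟨δ, hδ, hδ1, hδr⟩ : ∃ δ : ℝ, 0 < δ ∧ δ ≤ 1 ∧ (1 + δ + δ) * r < 1 := by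
    -- With `b = 1 + δ`, the automaton has row sums at most `1 + 2 * δ`, which must stay below `1 /
    -- r`.
    refine ⟨(1 - r) / 4, by linarith, by linarith, ?_⟩
    nlinarith
  have hrem := posSemidef_remainders hf hpos hZ hr (b := 1 + δ) (by linarith) hδ hδ1 hδr hZC
  have hsum := hasSum_apply_of_posSemidef_remainder (fun α =>
    (posSemidef_coeffMatrix hpos α).kronecker (posSemidef_monomial_of_posDef hZ α))
    (b := 1 + δ) (by linarith) (fun k => (hrem k).1) (fun k => (hrem k).2)
  have hmon : ∀ α, φ ((square v).monomial Z α) = x.prod.monomial x.tuple α := fun α => by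
    rw [map_monomial]
    simp only [hφZ]
  have hφp : ∀ p, φ (ncEval Z p) = ncEval x.tuple p := fun p => by
    rw [map_ncEval]
    simp only [hφZ]
  have hmem := scalarPoint_mem (v := v) (Z := Z) (b := 1) zero_le_one hZ hr (by linarith) hZC
  have hval : ∀ s t a c, scalarValue v Z f 1 (s, Sum.inr a) (t, Sum.inl c) =
      x.prod.toMatrix (f x s t) a c := fun s t a c => by
    obtain ⟨p, hp⟩ := (hf s t).exists_ncEval hmem
    have h := (hf s t).eq_ncEval hmem hx (fun q hq => by
      have h := sum_eq_zero_of_ncEval_eq_zero _ _ _ hq ((), ())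
      simp only [list_prod_scalarMatrix, Complex.ofReal_one, one_pow, mul_one] at h
      rw [← hφp, ncEval_apply]
      exact (congrArg φ h).trans (map_zero φ)) hp
    rw [scalarValue, diagBlock_apply _ _ _ hp, h, ← hφp, hφ, ncEval_apply, map_sum,
      Matrix.sum_apply]
    refine Finset.sum_congr rfl fun α _ => ?_
    rw [list_prod_scalarMatrix, map_smul, Matrix.smul_apply, smul_eq_mul, Complex.ofReal_one,
      one_pow, one_mul]
    rfl
  refine Pi.hasSum.2 fun ⟨s, a⟩ => Pi.hasSum.2 fun ⟨t, c⟩ => ?_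
  have := hsum (s, Sum.inr a) (t, Sum.inl c)
  rw [hval] at this
  change HasSum _ (x.prod.toMatrix (f x s t) a c)
  simpa only [Matrix.kroneckerMap_apply, ← hmon, hφ] using this

end SchurUniverse

end

theorem mainTheorem2 (d N : ℕ)
    (f : (x : SchurUniverse d) → Matrix (Fin N) (Fin N) x.prod.Alg)
    (hf : SchurUniverse.IsNCFunctionOn f (schurSpectralContractions d))
    (hpos : SchurUniverse.IsPositivityPreservingOn f (schurSpectralContractions d)) :
    ∃ c : List (Fin d) → Matrix (Fin N) (Fin N) ℂ,
      (∀ α, (c α).PosSemidef) ∧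
      ∀ x ∈ schurSpectralContractions d,
        HasSum (fun α : List (Fin d) => c α ⊗ₖ x.prod.toMatrix (x.prod.monomial x.tuple α))
          (x.prod.blockMatrix (f x)) :=
  ⟨SchurUniverse.coeffMatrix f, SchurUniverse.posSemidef_coeffMatrix hpos,
    fun _ hx => SchurUniverse.hasSum_coeffMatrix hf hpos hx⟩
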